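/- A two-armed bandit has reward distributions $\nu_1,\nu_2$ supported on $[0,1]$ with means $\mu_1,\mu_2$. Assume that arm $1$ is the unique best arm, i.e. $\mu^*=\mu_1>\mu_2$, and put $\Delta_2=\mu_1-\mu_2$. A demonstrator algorithm $\mathcal A$ (possibly randomized) chooses in each round $t\le T$ an arm $I_t\in\{1,2\}$ from the arms and rewards of the previous rounds and then receives a fresh reward $r_t\sim\nu_{I_t}$. Its expected regret is $\mathbb E[R_T]=T\mu^*-\mathbb E[\sum_{t=1}^T r_t]$. A reward estimator sees only $\mu^*$ and the actions $I_1,\dots,I_T$. For $\alpha\in[0,1)$ let $L=(T^\alpha-1)/\alpha$ ($L=\log T$ if $\alpha=0$) and let $C(n)=\sqrt{2L/n}$. Let $n_{i,t}$ be the number of pulls of arm $i$ in the first $t$ rounds, and let $\bar\mu_{i,t}$ be the sample mean of its rewards in those rounds. SAE pulls both arms once per epoch, in any order. At the end of epoch $n$ it drops an arm whose sample mean is at most the larger sample mean minus $2C(n)$, and from then on it pulls the other arm. UCB pulls a never-pulled arm if there is one, and otherwise an arm maximizing $\bar\mu_{i,t-1}+C(n_{i,t-1})$, with arbitrary tie-breaking.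 Let $\hat\imath$ be an arm pulled most often. The SAE estimator is $\hat\mu_i=\mu^*-2C(n_{i,\tau_i})$ for $i\ne\hat\imath$, where $\tau_i$ is the last round in which arm $i$ is pulled. The UCB estimator is $\hat\mu_i=\mu^*-\big(C(n_{i,\tau_i})-C(n_{\hat\imath,\tau_i})\big)$ for $i\neq\hat\imath$, where $\tau_i$ is the last round in which arm $i$ is pulled and after which $\hat\imath$ is pulled at least once. In both cases $\hat\mu_{\hat\imath}=\mu^*$. (a) There is a universal constant $C_0>0$ such that for every such bandit, every $\alpha\in[0,1)$ and every $T\ge2$ with $T\ge 64L/\Delta_2^2$, the SAE estimator applied to a demonstration of SAE, and the UCB estimator applied to a demonstration of UCB (each run with parameters $\alpha,T$), satisfy $$\mathbb E|\hat\mu_2-\mu_2|\le C_0\sqrt{\frac{\Delta_2}{\mathbb E[R_T]}}.$$ (b) Conversely, there is a universal constant $c>0$ such that for every two-armed Bernoulli bandit $\mathcal M$ with $\mu_1>\mu_2$ and $\max_i|\mu_i-\tfrac12|\le\tfrac14$, every horizon $T$ and every demonstrator algorithm $\mathcal A$, there is a two-armed Bernoulli bandit $\mathcal M'$ in which arm $1$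 is again the unique best arm, with the same best mean $\mu^*$, such that every reward estimator $\hat\mu_2$ satisfies $$\max_{\widetilde{\mathcal M}\in\{\mathcal M,\mathcal M'\}}\mathbb E_{\widetilde{\mathcal M}}\big|\hat\mu_2-\mu_2(\widetilde{\mathcal M})\big|\ \ge\ c\,\min\Big(\sqrt{\frac{\Delta_2}{\mathbb E_{\mathcal M}[R_T]}},\,1\Big),$$ where $\Delta_2$ and $\mathbb E_{\mathcal M}[R_T]$ refer to $\mathcal M$ and the minimum is $1$ if $\mathbb E_{\mathcal M}[R_T]=0$. -/

import Mathlib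

open MeasureTheory ProbabilityTheory

noncomputable section

namespace InverseBandit

/-- A two-armed bandit instance: one reward distribution on `[0,1]` per arm.
The arms `1, 2` are written `0, 1 : Fin 2`. -/
structure Bandit where
  /-- reward distribution of each arm -/
  reward : Fin 2 → Measure ℝ
  prob : ∀ i, IsProbabilityMeasure (reward i)
  supp : ∀ i, ∀ᵐ x ∂(reward i), x ∈ Set.Icc (0 : ℝ) 1

/-- Mean reward of arm `i`. -/
def Bandit.mean (B : Bandit) (i : Fin 2) : ℝ := ∫ x, x ∂(B.reward i)

/-- The best mean reward. -/
def Bandit.bestMean (B : Bandit) : ℝ := max (B.mean 0) (B.mean 1)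

/-- Suboptimality gap of arm `i`. -/
def Bandit.gap (B : Bandit) (i : Fin 2) : ℝ := B.bestMean - B.mean i

/-- All reward distributions are Bernoulli on `{0, 1}`. -/
def Bandit.IsBernoulli (B : Bandit) : Prop :=
  ∀ i, ∃ p : unitInterval, B.reward i = bernoulliMeasure (1 : ℝ) 0 p

/-- The first `t` rounds of play: the arm pulled and the reward received in each of them.
Round number `s + 1` has index `s`. -/
abbrev Hist (t : ℕ) : Type := Fin t → Fin 2 × ℝ

/-- The action sequence of a history; this is all that the reward estimator observes. -/
def actions {t : ℕ} (h : Hist t) : Fin t → Fin 2 := fun s => (h s).1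

/-- A (possibly randomized) demonstrator algorithm: the conditional law of the next arm
given the arms and rewards of the first `t` rounds. -/
structure Policy where
  /-- law of the arm pulled in round `t + 1`, given the first `t` rounds -/
  next : ∀ t, Kernel (Hist t) (Fin 2)
  markov : ∀ t, IsMarkovKernel (next t)

/-- The reward distributions as a kernel from arms to rewards. -/
def Bandit.rewardKernel (B : Bandit) : Kernel (Fin 2) ℝ :=
  Kernel.ofFunOfCountable B.reward

/-- One round: the arm is drawn by the policy, and the reward from that arm's distribution. -/
def stepKernel (B : Bandit) (π : Policy) (t : ℕ) : Kernel (Hist t) (Fin 2 × ℝ) :=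
  π.next t ⊗ₖ Kernel.prodMkLeft (Hist t) B.rewardKernel

/-- Appending a round to a history. -/
def addRound {t : ℕ} (h : Hist t) (x : Fin 2 × ℝ) : Hist (t + 1) :=
  Fin.snoc (α := fun _ => Fin 2 × ℝ) h x

/-- The law of the first `t` rounds when the policy `π` plays on the instance `B`. -/
def law (B : Bandit) (π : Policy) : ∀ t, Measure (Hist t)
  | 0 => Measure.dirac Fin.elim0
  | t + 1 => ((law B π t) ⊗ₘ (stepKernel B π t)).map (fun p => addRound p.1 p.2)

/-- Expected (pseudo-)regret `T μ* - E[∑ r_t]` over the horizon `T`. -/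
def regret (B : Bandit) (π : Policy) (T : ℕ) : ℝ :=
  T * B.bestMean - ∫ h, ∑ s, (h s).2 ∂(law B π T)

/-- Number of pulls of arm `i` in the first `n` rounds. -/
def pulls {t : ℕ} (a : Fin t → Fin 2) (n : ℕ) (i : Fin 2) : ℕ :=
  (Finset.univ.filter (fun s : Fin t => s.val < n ∧ a s = i)).card

/-- Average reward of arm `i` over its pulls in the first `n` rounds. -/
def sampleMean {t : ℕ} (h : Hist t) (n : ℕ) (i : Fin 2) : ℝ :=
  (∑ s ∈ Finset.univ.filter (fun s : Fin t => s.val < n ∧ (h s).1 = i), (h s).2)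
    / pulls (actions h) n i

/-- `(T ^ α - 1) / α`, read as its limit `log T` at `α = 0`. -/
def scale (α : ℝ) (T : ℕ) : ℝ :=
  if α = 0 then Real.log T else ((T : ℝ) ^ α - 1) / α

/-- Confidence width `√(2 (T ^ α - 1) / (α n))` of an arm pulled `n` times. -/
def width (α : ℝ) (T n : ℕ) : ℝ := Real.sqrt (2 * scale α T / n)

/-- Successive arm elimination: the set of active arms after `e` complete epochs. While both arms
are active each epoch pulls both of them once, so epoch `e + 1` ends after `2 (e + 1)` rounds; at
its end every active arm whose sample mean is at most the largest sample mean minus twice the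
width is dropped. -/
def saeActive (α : ℝ) (T : ℕ) {t : ℕ} (h : Hist t) : ℕ → Finset (Fin 2)
  | 0 => Finset.univ
  | e + 1 =>
    if 1 < (saeActive α T h e).card then
      (saeActive α T h e).filter (fun i =>
        ¬ sampleMean h (2 * (e + 1)) i ≤
          max (sampleMean h (2 * (e + 1)) 0) (sampleMean h (2 * (e + 1)) 1)
            - 2 * width α T (e + 1))
    else saeActive α T h e

/-- Arms that successive arm elimination may pull in round `t + 1`: an active arm with the fewest
pulls. While both arms are active this is an arm not yet pulled in the current epoch (in any
order within the epoch); afterwards it is the remaining arm. -/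
def saeAllowed (α : ℝ) (T : ℕ) {t : ℕ} (h : Hist t) : Set (Fin 2) :=
  {i | i ∈ saeActive α T h (t / 2) ∧
    ∀ j ∈ saeActive α T h (t / 2), pulls (actions h) t i ≤ pulls (actions h) t j}

/-- Arms that the upper confidence bound algorithm may pull in round `t + 1`: arms never pulled
(infinite width) come first; otherwise any maximizer of sample mean plus width. -/
def ucbAllowed (α : ℝ) (T : ℕ) {t : ℕ} (h : Hist t) : Set (Fin 2) :=
  {i | pulls (actions h) t i = 0 ∨
    ∀ j, pulls (actions h) t j ≠ 0 ∧
      sampleMean h t j + width α T (pulls (actions h) t j) ≤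
        sampleMean h t i + width α T (pulls (actions h) t i)}

/-- `π` is an implementation of successive arm elimination with parameter `α`, horizon `T`. -/
def IsSAE (α : ℝ) (T : ℕ) (π : Policy) : Prop :=
  ∀ t < T, ∀ h : Hist t, π.next t h (saeAllowed α T h) = 1

/-- `π` is an implementation of the upper confidence bound algorithm with parameter `α`,
horizon `T`, with arbitrary (possibly random) tie-breaking. -/
def IsUCB (α : ℝ) (T : ℕ) (π : Policy) : Prop :=
  ∀ t < T, ∀ h : Hist t, π.next t h (ucbAllowed α T h) = 1

/-- `best` selects, from the actions, an arm that is pulled most often. -/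
def IsMostPulled {T : ℕ} (best : (Fin T → Fin 2) → Fin 2) : Prop :=
  ∀ a i, pulls a T i ≤ pulls a T (best a)

/-- Switching round for successive arm elimination: the last round in which arm `i` is pulled
(`0` if there is none). -/
def saeSwitch {T : ℕ} (a : Fin T → Fin 2) (i : Fin 2) : ℕ :=
  (Finset.univ.filter (fun s : Fin T => a s = i ∧ ∀ s', s < s' → a s' ≠ i)).sup
    (fun s => s.val + 1)

/-- Switching round for the upper confidence bound algorithm: the last round in which arm `i` is
pulled and after which the arm `best` is pulled at least once (`0` if there is none). -/
def ucbSwitch {T : ℕ} (best : Fin 2) (a : Fin T → Fin 2) (i : Fin 2) : ℕ :=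
  (Finset.univ.filter (fun s : Fin T => a s = i ∧ ∃ s', s < s' ∧ a s' = best)).sup
    (fun s => s.val + 1)

/-- The reward estimate of arm `i` for successive arm elimination, from the actions and the best
mean `m`. The epoch in which an arm is pulled while active is its own number of pulls. The most
pulled arm gets the estimate `m`. -/
def saeEstimate (α : ℝ) {T : ℕ} (best : (Fin T → Fin 2) → Fin 2) (m : ℝ) (a : Fin T → Fin 2)
    (i : Fin 2) : ℝ :=
  if i = best a then m else m - 2 * width α T (pulls a (saeSwitch a i) i)

/-- The reward estimate of arm `i` for the upper confidence bound algorithm, from the actions and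
the best mean `m`. The most pulled arm gets the estimate `m`. -/
def ucbEstimate (α : ℝ) {T : ℕ} (best : (Fin T → Fin 2) → Fin 2) (m : ℝ) (a : Fin T → Fin 2)
    (i : Fin 2) : ℝ :=
  if i = best a then m
  else m - (width α T (pulls a (ucbSwitch (best a) a i) i)
    - width α T (pulls a (ucbSwitch (best a) a i) (best a)))

/-- Expected absolute error, for the mean of arm `i`, of an estimator `est` that sees the best mean
and the actions of `π` over the horizon `T` on the instance `B`. -/
def estError (B : Bandit) (π : Policy) (T : ℕ) (i : Fin 2)
    (est : ℝ → (Fin T → Fin 2) → ℝ) : ℝ :=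
  ∫ h, |est B.bestMean (actions h) - B.mean i| ∂(law B π T)

/-- `min (√(Δ / R)) 1`, where the square root is infinite at `R = 0`. -/
def cappedRate (Δ R : ℝ) : ℝ := if R = 0 then 1 else min (Real.sqrt (Δ / R)) 1

end InverseBandit

end

open InverseBandit

namespace InverseBandit

/-! ### Prefixes of histories and recursion over rounds -/

/-! Write L for `scale α T`, Δ for the gap and ν = L / Δ². Every rate is expressed through ν.

Upper bound. With probability at least 1 - 4/T all sample means stay within 3/4 of the confidence
width (`measureReal_deviantSet_le`). On that event both demonstrators pull the worse arm O(ν) times,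
so the regret, which is Δ times the expected number of such pulls (`regret_eq`), is O(Δν), and √(Δ /
R) is at least of order 1/√ν. It remains to prove an error of O(1/√ν).

At the switching round the demonstrator changes its mind, so two consecutive decisions bracket the
difference of sample means. SAE keeps the arm at width C(k) and drops it at C(k+1); UCB prefers the
worse arm with k pulls and the better arm once it has k+1. Hence the width expression in the
estimator equals Δ up to the deviations of the sample means and an increment C(k) - C(k+1), which is
itself O(1/√ν). The relevant pull counts are at least of order ν, so each deviation should be of
order 1/√ν, but the counts are random and a union bound would cost a logarithm. Instead one controls
the running maximum of the martingale with weights 1/(k+1+ν): its second moment is at most 4/ν by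
Doob's inequality (`integral_runMax_sq_le`, `integral_devMax_le`), and summation by parts returns to
sample means (`abs_transform_one_le`, `abs_sampleMean_sub_le`). Off the event the error is at most 1
+ √T, which contributes O(1/√T), and T ≥ 64ν. `estError_le_of_concentrated` turns the pathwise
statements `FollowsSAE.estimate` and `FollowsUCB.estimate` into the expected bound.

Lower bound. Lower the mean p of the second arm to p - k p(1-p); the best mean is unchanged. The
likelihood ratio of one reward r of that arm is 1 - k(r - p), so the ratio of a history is at least
3/4 - k²S² - 2k²n, with n the pulls of the arm and S its centred reward sum (`le_prod_ratio`). The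
expectation of this bound under the original instance involves only E n, that is, the regret there.
Le Cam's two-point argument with k² E n of constant order finishes (`le_estError_add_estError`,
`exists_hard_instance`).

All martingale arguments are run without filtrations: a potential on histories is shown not to
increase in mean under one more round, whatever arm is pulled (`integral_law_le`). -/

/-- The first `n` rounds of a history. -/
def restr {t n : ℕ} (hn : n ≤ t) (h : Hist t) : Hist n := fun s => h (Fin.castLE hn s)

lemma restr_addRound {t n : ℕ} (hn : n ≤ t) (h : Hist t) (x : Fin 2 × ℝ) :
    restr (Nat.le_succ_of_le hn) (addRound h x) = restr hn h := by
  funext s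
  have : Fin.castLE (Nat.le_succ_of_le hn) s = (Fin.castLE hn s).castSucc := rfl
  rw [restr, this, addRound, Fin.snoc_castSucc]
  rfl

lemma restr_self {t : ℕ} (h : Hist t) : restr le_rfl h = h := rfl

lemma addRound_last {t : ℕ} (h : Hist t) (x : Fin 2 × ℝ) : addRound h x (Fin.last t) = x := by
  simp [addRound]

lemma addRound_castSucc {t : ℕ} (h : Hist t) (x : Fin 2 × ℝ) (s : Fin t) :
    addRound h x s.castSucc = h s := by
  simp [addRound]

lemma sum_val_lt_eq {t n : ℕ} (hn : n ≤ t) (f : Fin t → ℝ) :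
    ∑ s, (if s.val < n then f s else 0) = ∑ s : Fin n, f (Fin.castLE hn s) := by
  obtain ⟨m, rfl⟩ := Nat.exists_eq_add_of_le hn
  rw [Fin.sum_univ_add]
  simp [Fin.castLE, Fin.castAdd]

lemma sum_val_lt_succ {t n : ℕ} (hn : n < t) (f : Fin t → ℝ) :
    ∑ s, (if s.val < n + 1 then f s else 0) = ∑ s, (if s.val < n then f s else 0) + f ⟨n, hn⟩ := by
  rw [sum_val_lt_eq hn, sum_val_lt_eq hn.le, Fin.sum_univ_castSucc]
  rfl

lemma cast_pulls {t : ℕ} (a : Fin t → Fin 2) (n : ℕ) (i : Fin 2) :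
    (pulls a n i : ℝ) = ∑ s, if s.val < n then (if a s = i then (1 : ℝ) else 0) else 0 := by
  simp [pulls, Finset.card_filter, ite_and]

lemma pulls_succ {t n : ℕ} (hn : n < t) (a : Fin t → Fin 2) (i : Fin 2) :
    pulls a (n + 1) i = pulls a n i + if a ⟨n, hn⟩ = i then 1 else 0 := by
  have := sum_val_lt_succ hn (fun s => if a s = i then (1 : ℝ) else 0)
  rw [← cast_pulls, ← cast_pulls] at this
  split_ifs at this ⊢ <;> exact_mod_cast this

lemma pulls_zero {t : ℕ} (a : Fin t → Fin 2) (i : Fin 2) : pulls a 0 i = 0 := by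
  simp [pulls]

lemma pulls_mono {t : ℕ} (a : Fin t → Fin 2) (i : Fin 2) {m n : ℕ} (h : m ≤ n) :
    pulls a m i ≤ pulls a n i := by
  apply Finset.card_le_card
  intro s
  simp only [Finset.mem_filter, Finset.mem_univ, true_and]
  exact fun hs => ⟨hs.1.trans_le h, hs.2⟩

lemma pulls_add {t n : ℕ} (hn : n ≤ t) (a : Fin t → Fin 2) : pulls a n 0 + pulls a n 1 = n := by
  induction n with
  | zero => simp [pulls_zero]
  | succ n ih =>
    rw [pulls_succ hn, pulls_succ hn]
    have := ih (Nat.le_of_succ_le hn)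
    have h2 : ∀ j : Fin 2, (if j = 0 then 1 else 0) + (if j = 1 then 1 else 0) = 1 := by decide
    have := h2 (a ⟨n, hn⟩)
    omega

lemma pulls_le {t : ℕ} (a : Fin t → Fin 2) (n : ℕ) (i : Fin 2) : pulls a n i ≤ t := by
  simpa [pulls] using (Finset.card_filter_le (Finset.univ : Finset (Fin t)) _)

lemma pulls_restr {t n m : ℕ} (hn : n ≤ t) (hm : m ≤ n) (h : Hist t) (i : Fin 2) :
    pulls (actions (restr hn h)) m i = pulls (actions h) m i := by
  have h1 := cast_pulls (actions (restr hn h)) m i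
  have h2 := cast_pulls (actions h) m i
  rw [sum_val_lt_eq hm] at h1
  rw [sum_val_lt_eq (hm.trans hn)] at h2
  have : (pulls (actions (restr hn h)) m i : ℝ) = pulls (actions h) m i := by
    rw [h1, h2]; rfl
  exact_mod_cast this

/-! ### Martingale transforms of the centred rewards and their running maxima -/

/-- The martingale transform of the centred rewards `r - m` of arm `i`, over the first `n` rounds,
the reward of the `(k+1)`-st pull being weighted by `G k`. -/
def transform (G : ℕ → ℝ) (i : Fin 2) (m : ℝ) {t : ℕ} (h : Hist t) (n : ℕ) : ℝ :=
  ∑ s : Fin t, if s.val < n then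
    (if (h s).1 = i then G (pulls (actions h) s i) * ((h s).2 - m) else 0) else 0

section transform

variable (G : ℕ → ℝ) (i : Fin 2) (m : ℝ)

lemma transform_zero {t : ℕ} (h : Hist t) : transform G i m h 0 = 0 := by simp [transform]

lemma transform_succ {t n : ℕ} (hn : n < t) (h : Hist t) :
    transform G i m h (n + 1) = transform G i m h n +
      if (h ⟨n, hn⟩).1 = i then G (pulls (actions h) n i) * ((h ⟨n, hn⟩).2 - m) else 0 :=
  sum_val_lt_succ hn _

lemma transform_restr {t n k : ℕ} (hn : n ≤ t) (hk : k ≤ n) (h : Hist t) :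
    transform G i m (restr hn h) k = transform G i m h k := by
  unfold transform
  rw [sum_val_lt_eq hk, sum_val_lt_eq (hk.trans hn)]
  refine Finset.sum_congr rfl fun s _ => ?_
  rw [pulls_restr hn (by simpa using (s.2.trans_le hk).le)]
  rfl

lemma pulls_addRound {t k : ℕ} (hk : k ≤ t) (h : Hist t) (x : Fin 2 × ℝ) :
    pulls (actions (addRound h x)) k i = pulls (actions h) k i := by
  rw [← pulls_restr (Nat.le_succ t) hk (addRound h x), restr_addRound le_rfl, restr_self]

lemma pulls_addRound_succ {t : ℕ} (h : Hist t) (x : Fin 2 × ℝ) :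
    pulls (actions (addRound h x)) (t + 1) i
      = pulls (actions h) t i + if x.1 = i then 1 else 0 := by
  rw [pulls_succ (Nat.lt_succ_self t), pulls_addRound i le_rfl]
  have : actions (addRound h x) ⟨t, Nat.lt_succ_self t⟩ = x.1 := by
    change (addRound h x (Fin.last t)).1 = _
    rw [addRound_last]
  rw [this]

lemma transform_addRound {t k : ℕ} (hk : k ≤ t) (h : Hist t) (x : Fin 2 × ℝ) :
    transform G i m (addRound h x) k = transform G i m h k := by
  rw [← transform_restr G i m (Nat.le_succ t) hk (addRound h x), restr_addRound le_rfl, restr_self]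

lemma transform_addRound_succ {t : ℕ} (h : Hist t) (x : Fin 2 × ℝ) :
    transform G i m (addRound h x) (t + 1) = transform G i m h t +
      if x.1 = i then G (pulls (actions h) t i) * (x.2 - m) else 0 := by
  rw [transform_succ G i m (Nat.lt_succ_self t), transform_addRound G i m le_rfl,
    pulls_addRound i le_rfl]
  have : addRound h x ⟨t, Nat.lt_succ_self t⟩ = x := addRound_last h x
  rw [this]

end transform

lemma sampleMean_sub {t : ℕ} (h : Hist t) (n : ℕ) (i : Fin 2) (m : ℝ)
    (hp : pulls (actions h) n i ≠ 0) :
    sampleMean h n i - m = transform (fun _ => 1) i m h n / pulls (actions h) n i := by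
  have hp' : (pulls (actions h) n i : ℝ) ≠ 0 := by exact_mod_cast hp
  rw [eq_div_iff hp', sub_mul, sampleMean, div_mul_cancel₀ _ hp', cast_pulls, transform,
    Finset.sum_filter, Finset.mul_sum, ← Finset.sum_sub_distrib]
  refine Finset.sum_congr rfl fun s _ => ?_
  simp only [actions, ite_and]
  split_ifs with h1 h2 <;> simp [*]

lemma sampleMean_restr {t n k : ℕ} (hn : n ≤ t) (hk : k ≤ n) (h : Hist t) (i : Fin 2) :
    sampleMean (restr hn h) k i = sampleMean h k i := by
  by_cases hp : pulls (actions h) k i = 0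
  · have hp' := hp
    rw [← pulls_restr hn hk] at hp'
    simp [sampleMean, hp, hp']
  · have h1 := sampleMean_sub h k i 0 hp
    rw [← pulls_restr hn hk] at hp
    have h2 := sampleMean_sub (restr hn h) k i 0 hp
    rw [transform_restr _ _ _ hn hk, pulls_restr hn hk] at h2
    linarith

/-- The first `n` centred rewards of an arm have the sum reached when it has been pulled `n`
times. -/
lemma transform_first {t k : ℕ} (i : Fin 2) (m : ℝ) (h : Hist t) :
    transform (fun j => if j < pulls (actions h) k i then 1 else 0) i m h t
      = transform (fun _ => 1) i m h k := by
  unfold transform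
  refine Finset.sum_congr rfl fun s _ => ?_
  simp only [s.2, if_true]
  by_cases hs : (h s).1 = i
  · simp only [hs, if_true]
    have hsucc : pulls (actions h) (s + 1) i = pulls (actions h) s i + 1 := by
      rw [pulls_succ s.2, if_pos]
      exact hs
    by_cases hlt : s.val < k
    · have := pulls_mono (actions h) i (Nat.succ_le_of_lt hlt)
      rw [Nat.succ_eq_add_one] at this
      rw [if_pos hlt, if_pos (by omega)]
    · have := pulls_mono (actions h) i (not_lt.mp hlt)
      rw [if_neg hlt, if_neg (by omega), zero_mul]
  · simp [hs]

/-- Running maximum of the absolute value of a transform. -/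
def runMax (G : ℕ → ℝ) (i : Fin 2) (m : ℝ) {t : ℕ} (h : Hist t) : ℕ → ℝ
  | 0 => 0
  | n + 1 => max (runMax G i m h n) |transform G i m h (n + 1)|

lemma runMax_nonneg (G : ℕ → ℝ) (i : Fin 2) (m : ℝ) {t : ℕ} (h : Hist t) (n : ℕ) :
    0 ≤ runMax G i m h n := by
  induction n with
  | zero => simp [runMax]
  | succ n ih => exact ih.trans (le_max_left _ _)

lemma abs_transform_le_runMax (G : ℕ → ℝ) (i : Fin 2) (m : ℝ) {t : ℕ} (h : Hist t) {k n : ℕ}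
    (hk : k ≤ n) : |transform G i m h k| ≤ runMax G i m h n := by
  induction n with
  | zero => obtain rfl : k = 0 := by omega
            simp [runMax, transform_zero]
  | succ n ih =>
    rcases Nat.lt_or_ge n k with h1 | h1
    · obtain rfl : k = n + 1 := by omega
      exact le_max_right _ _
    · exact (ih h1).trans (le_max_left _ _)

lemma runMax_addRound (G : ℕ → ℝ) (i : Fin 2) (m : ℝ) {t k : ℕ} (hk : k ≤ t) (h : Hist t)
    (x : Fin 2 × ℝ) : runMax G i m (addRound h x) k = runMax G i m h k := by
  induction k with
  | zero => simp [runMax]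
  | succ k ih => rw [runMax, runMax, ih (by omega), transform_addRound G i m hk]

/-- Summation by parts: the running maximum of the transform with weights `1 / (k + 1 + ν)`
controls the weighted partial sums. -/
lemma abs_transform_one_le {ν : ℝ} (hν : 0 < ν) (i : Fin 2) (m : ℝ) {T : ℕ} (h : Hist T) {n : ℕ}
    (hn : n ≤ T) :
    |transform (fun _ => 1) i m h n| ≤ 2 * (pulls (actions h) n i + ν) *
      runMax (fun k => 1 / ((k : ℝ) + 1 + ν)) i m h T := by
  set A := runMax (fun k => 1 / ((k : ℝ) + 1 + ν)) i m h T
  set Z := transform (fun k => 1 / ((k : ℝ) + 1 + ν)) i m h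
  have hZ : ∀ k ≤ T, |Z k| ≤ A := fun k hk => abs_transform_le_runMax _ i m h hk
  -- Abel summation: a pull changes (pulls + ν) Z - S by exactly the previous value of Z, which is
  -- at most A in absolute value.
  have key : ∀ k ≤ T, |(pulls (actions h) k i + ν) * Z k - transform (fun _ => 1) i m h k|
      ≤ pulls (actions h) k i * A := by
    intro k hk
    induction k with
    | zero => simp [Z, transform_zero, pulls_zero]
    | succ k ih =>
      have ih := ih (by omega)
      have hZs : Z (k + 1) = _ := transform_succ (fun k => 1 / ((k : ℝ) + 1 + ν)) i m hk h
      rw [hZs, transform_succ _ i m hk, pulls_succ hk]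
      change |_ * (Z k + _) - _| ≤ _
      by_cases hi : (h ⟨k, hk⟩).1 = i
      · have hi' : actions h ⟨k, hk⟩ = i := hi
        simp only [hi, hi', if_true]
        set p : ℝ := (pulls (actions h) k i : ℝ)
        have hp : 0 ≤ p := Nat.cast_nonneg _
        have hpν : p + 1 + ν ≠ 0 := by positivity
        have e : ((pulls (actions h) k i + 1 : ℕ) + ν) *
            (Z k + 1 / (p + 1 + ν) * ((h ⟨k, hk⟩).2 - m)) -
            (transform (fun _ => 1) i m h k + 1 * ((h ⟨k, hk⟩).2 - m))
            = ((p + ν) * Z k - transform (fun _ => 1) i m h k) + Z k := by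
          push_cast
          change (p + 1 + ν) * _ - _ = _
          field_simp
          ring
        rw [e]
        refine (abs_add_le _ _).trans ?_
        have := hZ k (by omega)
        push_cast
        change _ ≤ (p + 1) * A
        linarith
      · have hi' : ¬ actions h ⟨k, hk⟩ = i := hi
        simpa [hi, hi'] using ih
  have h1 := key n hn
  have h2 := hZ n hn
  have hp : (0 : ℝ) ≤ pulls (actions h) n i := Nat.cast_nonneg _
  have hA : 0 ≤ A := runMax_nonneg _ i m h T
  have h3 : |(pulls (actions h) n i + ν) * Z n| ≤ (pulls (actions h) n i + ν) * A := by
    rw [abs_mul, abs_of_nonneg (by positivity)]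
    gcongr
  have e : transform (fun _ => 1) i m h n = (pulls (actions h) n i + ν) * Z n -
    ((pulls (actions h) n i + ν) * Z n - transform (fun _ => 1) i m h n) := by ring
  rw [e]
  refine (abs_sub _ _).trans ?_
  nlinarith [mul_nonneg hν.le hA]

/-! ### Measurability -/

instance (B : Bandit) (i : Fin 2) : IsProbabilityMeasure (B.reward i) := B.prob i

instance (π : Policy) (t : ℕ) : IsMarkovKernel (π.next t) := π.markov t

instance (B : Bandit) : IsMarkovKernel B.rewardKernel :=
  ⟨fun i => B.prob i⟩

instance (B : Bandit) (π : Policy) (t : ℕ) : IsMarkovKernel (stepKernel B π t) := by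
  unfold stepKernel; infer_instance

lemma measurable_addRound {t : ℕ} :
    Measurable (fun p : Hist t × (Fin 2 × ℝ) => addRound p.1 p.2) := by
  refine measurable_pi_iff.mpr fun s => ?_
  refine Fin.lastCases ?_ (fun s => ?_) s
  · simp only [addRound_last]; fun_prop
  · simp only [addRound_castSucc]; fun_prop

lemma measurable_actions {t : ℕ} : Measurable (actions (t := t)) := by
  unfold actions; fun_prop

lemma measurable_of_actions {t : ℕ} {β : Type*} [MeasurableSpace β] (f : (Fin t → Fin 2) → β) :
    Measurable (fun h : Hist t => f (actions h)) :=
  (measurable_of_countable f).comp measurable_actions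

lemma measurable_pulls {t : ℕ} (n : ℕ) (i : Fin 2) :
    Measurable (fun h : Hist t => pulls (actions h) n i) :=
  measurable_of_actions (fun a => pulls a n i)

lemma measurableSet_arm {t : ℕ} (s : Fin t) (i : Fin 2) :
    MeasurableSet {h : Hist t | (h s).1 = i} :=
  measurableSet_eq_fun (by fun_prop) measurable_const

lemma measurable_transform (G : ℕ → ℝ) (i : Fin 2) (m : ℝ) {t : ℕ} (n : ℕ) :
    Measurable (fun h : Hist t => transform G i m h n) := by
  unfold transform
  refine Finset.measurable_sum _ fun s _ => ?_
  by_cases hs : s.val < n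
  · simp only [hs, if_true]
    refine Measurable.ite (measurableSet_arm s i) ?_ measurable_const
    exact (measurable_of_actions (fun a => G (pulls a s i))).mul (by fun_prop)
  · simp [hs]

lemma measurable_sampleMean {t : ℕ} (n : ℕ) (i : Fin 2) :
    Measurable (fun h : Hist t => sampleMean h n i) := by
  have : (fun h : Hist t => sampleMean h n i) = fun h => transform (fun _ => 1) i 0 h n /
      pulls (actions h) n i := by
    funext h
    by_cases hp : pulls (actions h) n i = 0
    · simp [sampleMean, hp]
    · rw [← sampleMean_sub h n i 0 hp, sub_zero]
  rw [this]
  exact (measurable_transform _ _ _ _).div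
    (measurable_of_actions (fun a => (pulls a n i : ℝ)))

lemma measurable_runMax (G : ℕ → ℝ) (i : Fin 2) (m : ℝ) {t : ℕ} (n : ℕ) :
    Measurable (fun h : Hist t => runMax G i m h n) := by
  induction n with
  | zero => simp [runMax]
  | succ n ih =>
    simp only [runMax]
    exact ih.max (measurable_transform G i m (n + 1)).norm

/-! ### The law of a history, one round at a time -/

instance (B : Bandit) (π : Policy) (t : ℕ) : IsProbabilityMeasure (law B π t) := by
  induction t with
  | zero => rw [law]; infer_instance
  | succ t ih =>
    rw [law]
    exact Measure.isProbabilityMeasure_map measurable_addRound.aemeasurable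

lemma lintegral_law_succ (B : Bandit) (π : Policy) (t : ℕ) {F : Hist (t + 1) → ENNReal}
    (hF : Measurable F) :
    ∫⁻ h, F h ∂(law B π (t + 1)) =
      ∫⁻ h, ∫⁻ i, ∫⁻ r, F (addRound h (i, r)) ∂(B.reward i) ∂(π.next t h) ∂(law B π t) := by
  rw [law, lintegral_map hF measurable_addRound,
    Measure.lintegral_compProd (f := fun p : Hist t × (Fin 2 × ℝ) => F (addRound p.1 p.2))
      (hF.comp measurable_addRound)]
  refine lintegral_congr fun h => ?_
  rw [stepKernel, Kernel.lintegral_compProd (f := fun x : Fin 2 × ℝ => F (addRound h x)) _ _ _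
    ((hF.comp measurable_addRound).comp measurable_prodMk_left)]
  rfl

lemma ae_law_succ (B : Bandit) (π : Policy) (t : ℕ) {p : Hist (t + 1) → Prop}
    (hp : MeasurableSet {h | p h})
    (h : ∀ᵐ h ∂(law B π t), ∀ᵐ i ∂(π.next t h), ∀ᵐ r ∂(B.reward i), p (addRound h (i, r))) :
    ∀ᵐ h ∂(law B π (t + 1)), p h := by
  rw [law, ae_map_iff measurable_addRound.aemeasurable hp]
  refine Measure.ae_compProd_of_ae_ae (measurable_addRound hp) ?_
  filter_upwards [h] with h hh
  exact Kernel.ae_compProd_of_ae_ae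
    ((measurable_addRound.comp measurable_prodMk_left) hp) hh

/-- All rewards of the history lie in the unit interval. -/
def UnitRewards {t : ℕ} (h : Hist t) : Prop := ∀ s, (h s).2 ∈ Set.Icc (0 : ℝ) 1

lemma measurableSet_unitRewards {t : ℕ} : MeasurableSet {h : Hist t | UnitRewards h} := by
  simp only [UnitRewards, Set.ofPred_forall]
  exact MeasurableSet.iInter fun s => measurableSet_Icc.preimage (by fun_prop)

lemma UnitRewards.addRound {t : ℕ} {h : Hist t} (hh : UnitRewards h) (i : Fin 2) {r : ℝ}
    (hr : r ∈ Set.Icc (0 : ℝ) 1) : UnitRewards (addRound h (i, r)) := by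
  intro s
  refine Fin.lastCases ?_ (fun s => ?_) s
  · rwa [addRound_last]
  · rw [addRound_castSucc]; exact hh s

lemma ae_unitRewards (B : Bandit) (π : Policy) (t : ℕ) :
    ∀ᵐ h ∂(law B π t), UnitRewards h := by
  induction t with
  | zero => exact Filter.Eventually.of_forall fun h s => s.elim0
  | succ t ih =>
    refine ae_law_succ B π t measurableSet_unitRewards ?_
    filter_upwards [ih] with h hh
    refine Filter.Eventually.of_forall fun i => ?_
    filter_upwards [B.supp i] with r hr using hh.addRound i hr

/-- If the policy only pulls arms from `allowed`, then almost surely so does the history. -/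
lemma ae_allowed (B : Bandit) (π : Policy) (T : ℕ) (allowed : ∀ t, Hist t → Set (Fin 2))
    (hmeas : ∀ t i, MeasurableSet {h : Hist t | i ∈ allowed t h})
    (hπ : ∀ t < T, ∀ h : Hist t, π.next t h (allowed t h) = 1) :
    ∀ᵐ h ∂(law B π T), ∀ t (ht : t < T), (h ⟨t, ht⟩).1 ∈ allowed t (restr ht.le h) := by
  induction T with
  | zero => exact Filter.Eventually.of_forall fun h t ht => absurd ht (Nat.not_lt_zero t)
  | succ T ih =>
    refine ae_law_succ B π T ?_ ?_
    · simp only [Set.ofPred_forall]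
      refine MeasurableSet.iInter fun t => MeasurableSet.iInter fun ht => ?_
      have : {h : Hist (T + 1) | (h ⟨t, ht⟩).1 ∈ allowed t (restr ht.le h)} =
          ⋃ i : Fin 2, {h | (h ⟨t, ht⟩).1 = i} ∩ {h | i ∈ allowed t (restr ht.le h)} := by
        ext h; simp
      rw [this]
      refine MeasurableSet.iUnion fun i => (measurableSet_arm _ i).inter ?_
      have hm : Measurable (fun h : Hist (T + 1) => restr ht.le h) := by
        unfold restr; fun_prop
      exact hm (hmeas t i)
    · filter_upwards [ih fun t ht => hπ t (by omega)] with h hh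
      have h1 : ∀ᵐ i ∂(π.next T h), i ∈ allowed T h := by
        exact (mem_ae_iff_prob_eq_one (MeasurableSet.of_discrete)).mpr (hπ T (by omega) h)
      filter_upwards [h1] with i hi
      refine Filter.Eventually.of_forall fun r t ht => ?_
      rcases Nat.lt_succ_iff_lt_or_eq.mp ht with h2 | rfl
      · have := hh t h2
        rw [← restr_addRound h2.le h (i, r)] at this
        have e : addRound h (i, r) ⟨t, ht⟩ = h ⟨t, h2⟩ := addRound_castSucc h (i, r) ⟨t, h2⟩
        rw [e]
        exact this
      · have e : addRound h (i, r) ⟨t, ht⟩ = (i, r) := addRound_last h (i, r)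
        rw [e, restr_addRound le_rfl, restr_self]
        exact hi

lemma integrable_of_unitRewards {B : Bandit} {π : Policy} {t : ℕ} {F : Hist t → ℝ}
    (hF : Measurable F) {K : ℝ} (hK : ∀ h, UnitRewards h → |F h| ≤ K) :
    Integrable F (law B π t) := by
  refine Integrable.of_bound hF.aestronglyMeasurable K ?_
  filter_upwards [ae_unitRewards B π t] with h hh using hK h hh

/-- The one-round bound is required for each arm separately, so averaging over the policy is
harmless and no property of the policy is needed. -/
lemma integral_law_succ_le (B : Bandit) (π : Policy) (t : ℕ) {F : Hist (t + 1) → ℝ}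
    {F' : Hist t → ℝ} (hF : Measurable F) (hI : Integrable F (law B π (t + 1)))
    (hI' : Integrable F' (law B π t))
    (hstep : ∀ h, UnitRewards h → ∀ i, ∫ r, F (addRound h (i, r)) ∂(B.reward i) ≤ F' h) :
    ∫ h, F h ∂(law B π (t + 1)) ≤ ∫ h, F' h ∂(law B π t) := by
  have hm : Measurable fun p : Hist t × (Fin 2 × ℝ) => F (addRound p.1 p.2) :=
    hF.comp measurable_addRound
  rw [law] at hI ⊢
  rw [integral_map measurable_addRound.aemeasurable hF.aestronglyMeasurable]
  have hI2 : Integrable (fun p : Hist t × (Fin 2 × ℝ) => F (addRound p.1 p.2))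
      (law B π t ⊗ₘ stepKernel B π t) :=
    (integrable_map_measure hF.aestronglyMeasurable measurable_addRound.aemeasurable).mp hI
  rw [Measure.integral_compProd hI2]
  have hI3 := (Measure.integrable_compProd_iff hm.aestronglyMeasurable).mp hI2
  have hI4 : Integrable (fun h => ∫ x, F (addRound h x) ∂(stepKernel B π t h)) (law B π t) :=
    Integrable.integral_compProd (a := ()) (κ := Kernel.const Unit (law B π t))
      (η := Kernel.prodMkLeft Unit (stepKernel B π t)) hI2
  refine integral_mono_ae hI4 hI' ?_
  filter_upwards [hI3.1, ae_unitRewards B π t] with h hh hu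
  unfold stepKernel at hh ⊢
  rw [ProbabilityTheory.integral_compProd hh]
  calc ∫ i, ∫ r, F (addRound h (i, r)) ∂(B.reward i) ∂(π.next t h)
      ≤ ∫ _, F' h ∂(π.next t h) :=
        integral_mono (Integrable.of_finite) (integrable_const _) (hstep h hu)
    _ = F' h := by simp

/-- A potential that does not increase in conditional mean has expectation at most its initial
value. -/
lemma integral_law_le (B : Bandit) (π : Policy) (F : ∀ t, Hist t → ℝ)
    (hF : ∀ t, Measurable (F t)) (K : ℕ → ℝ) (hK : ∀ t h, UnitRewards h → |F t h| ≤ K t)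
    (hstep : ∀ t h, UnitRewards h → ∀ i,
      ∫ r, F (t + 1) (addRound h (i, r)) ∂(B.reward i) ≤ F t h) (T : ℕ) :
    ∫ h, F T h ∂(law B π T) ≤ F 0 Fin.elim0 := by
  induction T with
  | zero => rw [law, integral_dirac' _ _ (hF 0).stronglyMeasurable]
  | succ t ih =>
    exact (integral_law_succ_le B π t (hF _) (integrable_of_unitRewards (hF _) (hK _))
      (integrable_of_unitRewards (hF _) (hK _)) (hstep t)).trans ih

/-! ### Martingale estimates -/

lemma integrable_reward (B : Bandit) (i : Fin 2) : Integrable (fun x => x) (B.reward i) :=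
  Integrable.of_mem_Icc 0 1 aemeasurable_id (B.supp i)

lemma mean_mem_Icc (B : Bandit) (i : Fin 2) : B.mean i ∈ Set.Icc (0 : ℝ) 1 := by
  constructor
  · exact integral_nonneg_of_ae ((B.supp i).mono fun x hx => hx.1)
  · calc B.mean i ≤ ∫ _, (1 : ℝ) ∂(B.reward i) :=
        integral_mono_ae (integrable_reward B i) (integrable_const _)
          ((B.supp i).mono fun x hx => hx.2)
      _ = 1 := by simp

lemma integral_reward_affine (B : Bandit) (i : Fin 2) (a b : ℝ) :
    ∫ r, (a + b * (r - B.mean i)) ∂(B.reward i) = a := by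
  have h := integrable_reward B i
  have h2 : Integrable (fun r => b * (r - B.mean i)) (B.reward i) :=
    (h.sub (integrable_const _)).const_mul _
  rw [integral_add (integrable_const _) h2, integral_const_mul,
    integral_sub h (integrable_const _)]
  simp [Bandit.mean]

/-- The centred linear term integrates to zero. A one-round supermartingale inequality thus becomes
a pointwise affine bound, with a slope that may depend on the past. -/
lemma integral_reward_le_of_affine (B : Bandit) (i : Fin 2) {f : ℝ → ℝ} (hf : Measurable f)
    (a b K : ℝ) (hK : ∀ r ∈ Set.Icc (0 : ℝ) 1, |f r| ≤ K)
    (h : ∀ r ∈ Set.Icc (0 : ℝ) 1, f r ≤ a + b * (r - B.mean i)) :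
    ∫ r, f r ∂(B.reward i) ≤ a := by
  rw [← integral_reward_affine B i a b]
  refine integral_mono_ae ?_ ?_ ((B.supp i).mono h)
  · exact Integrable.of_bound hf.aestronglyMeasurable K ((B.supp i).mono hK)
  · exact (integrable_const _).add
      (((integrable_reward B i).sub (integrable_const _)).const_mul _)

lemma measurable_addRound_arm {t : ℕ} (h : Hist t) (i : Fin 2) :
    Measurable fun r : ℝ => addRound h (i, r) :=
  (measurable_addRound.comp (measurable_prodMk_left (x := h))).comp measurable_prodMk_left

/-- A crude bound, serving only integrability. -/
lemma abs_transform_le {G : ℕ → ℝ} (hG : ∀ k, |G k| ≤ 1) (i : Fin 2) {m : ℝ}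
    (hm : m ∈ Set.Icc (0 : ℝ) 1) {t : ℕ} {h : Hist t} (hh : UnitRewards h) (n : ℕ) :
    |transform G i m h n| ≤ t := by
  unfold transform
  refine (Finset.abs_sum_le_sum_abs _ _).trans ?_
  have : ∀ s : Fin t, |if s.val < n then
    (if (h s).1 = i then G (pulls (actions h) s i) * ((h s).2 - m) else 0) else 0| ≤ 1 := by
    intro s
    split_ifs
    · rw [abs_mul]
      have h1 := hG (pulls (actions h) s i)
      have h2 : |(h s).2 - m| ≤ 1 := by
        rw [abs_le]
        constructor <;> linarith [(hh s).1, (hh s).2, hm.1, hm.2]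
      nlinarith [abs_nonneg ((h s).2 - m), abs_nonneg (G (pulls (actions h) s i))]
    · simp
    · simp
  simpa using Finset.sum_le_sum fun s (_ : s ∈ Finset.univ) => this s

lemma runMax_le {G : ℕ → ℝ} (hG : ∀ k, |G k| ≤ 1) (i : Fin 2) {m : ℝ}
    (hm : m ∈ Set.Icc (0 : ℝ) 1) {t : ℕ} {h : Hist t} (hh : UnitRewards h) (n : ℕ) :
    runMax G i m h n ≤ t := by
  induction n with
  | zero => simp [runMax]
  | succ n ih => exact max_le ih (abs_transform_le hG i hm hh _)

/-- The free factor `c` lets the one-sided supermartingale lemma yield equality, by taking `c = 1`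
and `c = -1`. -/
lemma integral_mul_transform_le (B : Bandit) (π : Policy) (T : ℕ) (i : Fin 2) {G : ℕ → ℝ}
    (hG : ∀ k, |G k| ≤ 1) (c : ℝ) :
    ∫ h, c * transform G i (B.mean i) h T ∂(law B π T) ≤ 0 := by
  have hm := mean_mem_Icc B i
  have := integral_law_le B π (fun t h => c * transform G i (B.mean i) h t)
    (fun t => (measurable_transform _ _ _ _).const_mul _) (fun t => |c| * t)
    (fun t h hh => by
      rw [abs_mul]
      exact mul_le_mul_of_nonneg_left (abs_transform_le hG i hm hh t) (abs_nonneg _))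
    (fun t h hh j => by
      refine integral_reward_le_of_affine B j
        (((measurable_transform _ _ _ _).const_mul _).comp (measurable_addRound_arm h j)) _
        (if j = i then c * G (pulls (actions h) t i) else 0) (|c| * (t + 1 : ℕ)) ?_ ?_
      · intro r hr
        rw [Function.comp_apply, abs_mul]
        exact mul_le_mul_of_nonneg_left (abs_transform_le hG i hm (hh.addRound j hr) _)
          (abs_nonneg _)
      · intro r hr
        rw [Function.comp_apply, transform_addRound_succ]
        by_cases hj : j = i
        · subst hj; simp only [if_true]; apply le_of_eq; ring
        · simp [hj]) T
  simpa [transform_zero] using this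

lemma integral_transform (B : Bandit) (π : Policy) (T : ℕ) (i : Fin 2) {G : ℕ → ℝ}
    (hG : ∀ k, |G k| ≤ 1) :
    ∫ h, transform G i (B.mean i) h T ∂(law B π T) = 0 := by
  have h1 := integral_mul_transform_le B π T i hG 1
  have h2 := integral_mul_transform_le B π T i hG (-1)
  simp only [integral_const_mul] at h1 h2
  linarith

/-! ### Maximal and exponential inequalities for transforms -/

section weights

variable {G W : ℕ → ℝ} (hW0 : W 0 = 0) (hW : ∀ k, G k ^ 2 ≤ W (k + 1) - W k)
include hW

/-- Increments of `W` dominate the squares of `G`, and centred rewards have absolute value at most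
1, so `W` at the pull count dominates the quadratic variation of the transform. -/
lemma weight_mono : Monotone W :=
  monotone_nat_of_le_succ fun k => by linarith [hW k, sq_nonneg (G k)]

include hW0

lemma weight_nonneg (k : ℕ) : 0 ≤ W k := hW0 ▸ weight_mono hW (Nat.zero_le k)

/-- Doob's `L²` maximal inequality for transforms. -/
lemma integral_runMax_sq_le (hG : ∀ k, |G k| ≤ 1) (B : Bandit) (π : Policy) (T : ℕ) (i : Fin 2) :
    ∫ h, (runMax G i (B.mean i) h T) ^ 2 ∂(law B π T)
      ≤ 4 * ∫ h, W (pulls (actions h) T i) ∂(law B π T) := by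
  set m := B.mean i
  have hm : m ∈ Set.Icc (0 : ℝ) 1 := mean_mem_Icc B i
  -- Pathwise form of Doob's inequality: with A the running maximum and Z the transform, F - (A² -
  -- 4W) = (A - 2|Z|)² ≥ 0, and F starts at 0. Only the decrease of F in mean remains.
  let F : ∀ t, Hist t → ℝ := fun t h => 2 * runMax G i m h t ^ 2
    - 4 * runMax G i m h t * |transform G i m h t| + 4 * transform G i m h t ^ 2
    - 4 * W (pulls (actions h) t i)
  have hFm : ∀ t, Measurable (F t) := fun t => by
    have h1 := measurable_runMax G i m (t := t) t
    have h2 := measurable_transform G i m (t := t) t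
    have h3 := measurable_of_actions (t := t) (fun a => W (pulls a t i))
    have h4 : Measurable (fun h : Hist t => |transform G i m h t|) := h2.norm
    exact ((((h1.pow_const 2).const_mul 2).sub ((h1.const_mul 4).mul h4)).add
      ((h2.pow_const 2).const_mul 4)).sub (h3.const_mul 4)
  have hWb : ∀ t (h : Hist t), |W (pulls (actions h) t i)| ≤ W t := fun t h => by
    rw [abs_of_nonneg (weight_nonneg hW0 hW _)]
    exact weight_mono hW (pulls_le _ _ _)
  have hFK : ∀ t h, UnitRewards h → |F t h| ≤ 10 * t ^ 2 + 4 * W t := by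
    intro t h hh
    have h1 := runMax_le hG i hm hh t
    have h2 := runMax_nonneg G i m h t
    have h3 := abs_transform_le hG i hm hh t
    have h4 := hWb t h
    have h5 := abs_nonneg (transform G i m h t)
    have h6 := abs_nonneg (W (pulls (actions h) t i))
    have e1 : runMax G i m h t ^ 2 ≤ t ^ 2 := by gcongr
    have e2 : |transform G i m h t| ^ 2 ≤ t ^ 2 := by gcongr
    have e3 : runMax G i m h t * |transform G i m h t| ≤ t ^ 2 := by
      rw [sq]; gcongr
    have e5 : 0 ≤ runMax G i m h t * |transform G i m h t| := by positivity
    rw [sq_abs] at e2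
    have e4 := abs_le.mp h4
    simp only [F]
    rw [abs_le]
    constructor <;> nlinarith [sq_nonneg (runMax G i m h t), sq_nonneg (transform G i m h t)]
  have main := integral_law_le B π F hFm _ hFK (fun t h hh j => by
    -- The slope collects what is linear in the new reward: 8Z from the square, and -4A sgn Z from
    -- |Z + Gx| ≥ |Z| + sgn(Z) Gx. Updating A to the new maximum only lowers 2A² - 4A|Z + Gx|, which
    -- is minimal at A = |Z + Gx|.
    refine integral_reward_le_of_affine B j ((hFm (t + 1)).comp (measurable_addRound_arm h j)) _
      (if j = i then (8 * transform G i m h t - 4 * runMax G i m h t *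
        (if 0 ≤ transform G i m h t then 1 else -1)) * G (pulls (actions h) t i) else 0)
      _ (fun r hr => hFK _ _ (hh.addRound j hr)) ?_
    intro r hr
    simp only [Function.comp_apply, F]
    rw [runMax, runMax_addRound G i m le_rfl, transform_addRound_succ, pulls_addRound_succ]
    by_cases hj : j = i
    · subst hj
      simp only [if_true]
      set Z := transform G j m h t
      set A := runMax G j m h t
      set n := pulls (actions h) t j
      set x := r - B.mean j with hx
      change 2 * max A |Z + G n * x| ^ 2 - 4 * max A |Z + G n * x| * |Z + G n * x|
        + 4 * (Z + G n * x) ^ 2 - 4 * W (n + 1) ≤ _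
      have hA : 0 ≤ A := runMax_nonneg _ _ _ _ _
      have hx1 : x ^ 2 ≤ 1 := by
        rw [sq_le_one_iff_abs_le_one, abs_le]
        have hm' : B.mean j ∈ Set.Icc (0 : ℝ) 1 := hm
        constructor <;> linarith [hr.1, hr.2, hm'.1, hm'.2]
      have hGx : (G n * x) ^ 2 ≤ W (n + 1) - W n := by
        rw [mul_pow]
        nlinarith [hW n, sq_nonneg (G n), sq_nonneg x]
      have e1 : 2 * max A |Z + G n * x| ^ 2 - 4 * max A |Z + G n * x| * |Z + G n * x|
          ≤ 2 * A ^ 2 - 4 * A * |Z + G n * x| := by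
        rcases le_total |Z + G n * x| A with h1 | h1
        · rw [max_eq_left h1]
        · rw [max_eq_right h1]
          nlinarith [sq_nonneg (|Z + G n * x| - A)]
      have e2 : |Z| + (if 0 ≤ Z then 1 else -1) * (G n * x) ≤ |Z + G n * x| := by
        split_ifs with h0
        · rw [abs_of_nonneg h0]; linarith [le_abs_self (Z + G n * x)]
        · rw [abs_of_neg (not_le.mp h0)]; linarith [neg_le_abs (Z + G n * x)]
      have e3 := mul_le_mul_of_nonneg_left e2 hA
      nlinarith
    · simp only [hj, if_false, add_zero]
      rw [max_eq_left (abs_transform_le_runMax _ _ _ _ le_rfl)]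
      simp) T
  have hF0 : F 0 Fin.elim0 = 0 := by simp [F, runMax, transform_zero, pulls_zero, hW0]
  rw [hF0] at main
  have hIW : Integrable (fun h => W (pulls (actions h) T i)) (law B π T) :=
    integrable_of_unitRewards (measurable_of_actions (fun a => W (pulls a T i)))
      fun h _ => hWb T h
  have hIA : Integrable (fun h => runMax G i m h T ^ 2) (law B π T) :=
    integrable_of_unitRewards (K := (T : ℝ) ^ 2) ((measurable_runMax G i m T).pow_const 2)
      fun h hh => by
        rw [abs_of_nonneg (sq_nonneg _)]
        have h1 := runMax_le hG i hm hh T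
        have h2 := runMax_nonneg G i m h T
        gcongr
  have hIF : Integrable (F T) (law B π T) := integrable_of_unitRewards (hFm T) (hFK T)
  have h2 : ∫ h, (runMax G i m h T ^ 2 - 4 * W (pulls (actions h) T i)) ∂(law B π T)
      ≤ ∫ h, F T h ∂(law B π T) := by
    refine integral_mono (hIA.sub (hIW.const_mul 4)) hIF fun h => ?_
    simp only [F]
    nlinarith [sq_nonneg (runMax G i m h T - 2 * |transform G i m h T|),
      sq_abs (transform G i m h T)]
  rw [integral_sub hIA (hIW.const_mul 4), integral_const_mul] at h2
  linarith

/-- Exponential supermartingale bound for transforms, from Hoeffding's lemma. -/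
lemma integral_exp_transform_le (hG : ∀ k, |G k| ≤ 1) (B : Bandit) (π : Policy) (T : ℕ)
    (i : Fin 2) (c : ℝ) :
    ∫ h, Real.exp (c * transform G i (B.mean i) h T - c ^ 2 / 8 * W (pulls (actions h) T i))
      ∂(law B π T) ≤ 1 := by
  set m := B.mean i
  have hm : m ∈ Set.Icc (0 : ℝ) 1 := mean_mem_Icc B i
  have main := integral_law_le B π
    (fun t h => Real.exp (c * transform G i m h t - c ^ 2 / 8 * W (pulls (actions h) t i)))
    (fun t => Real.measurable_exp.comp (((measurable_transform _ _ _ _).const_mul _).sub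
      (measurable_of_actions (fun a => c ^ 2 / 8 * W (pulls a t i)))))
    (fun t => Real.exp (|c| * t))
    (fun t h hh => by
      rw [abs_of_pos (Real.exp_pos _), Real.exp_le_exp]
      have h1 := weight_nonneg hW0 hW (pulls (actions h) t i)
      have h2 : c * transform G i m h t ≤ |c| * t :=
        (le_abs_self _).trans (by
          rw [abs_mul]
          exact mul_le_mul_of_nonneg_left (abs_transform_le hG i hm hh t) (abs_nonneg _))
      have := mul_nonneg (by positivity : 0 ≤ c ^ 2 / 8) h1
      linarith)
    (fun t h hh j => by
      simp only [transform_addRound_succ, pulls_addRound_succ]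
      by_cases hj : j = i
      · subst hj
        simp only [if_true]
        set Z := transform G j m h t
        set n := pulls (actions h) t j
        have hs := hasSubgaussianMGF_of_mem_Icc (X := fun x => x) aemeasurable_id (B.supp j)
        have h1 := hs.mgf_le (c * G n)
        -- Hoeffding's variance proxy on an interval of length 1 is 1/4, whence the factor c²/8 in
        -- front of W.
        have e : (((‖(1 : ℝ) - 0‖₊ / 2) ^ 2 : NNReal) : ℝ) = 1 / 4 := by
          push_cast; norm_num
        rw [e, mgf] at h1
        have e2 : ∀ r : ℝ, Real.exp (c * (Z + G n * (r - m)) - c ^ 2 / 8 * W (n + 1))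
            = Real.exp (c * Z - c ^ 2 / 8 * W (n + 1)) * Real.exp (c * G n * (r - m)) := by
          intro r; rw [← Real.exp_add]; congr 1; ring
        simp only [e2]
        rw [integral_const_mul]
        calc _ ≤ Real.exp (c * Z - c ^ 2 / 8 * W (n + 1)) *
              Real.exp (1 / 4 * (c * G n) ^ 2 / 2) :=
              mul_le_mul_of_nonneg_left h1 (Real.exp_pos _).le
          _ ≤ _ := by
            rw [← Real.exp_add, Real.exp_le_exp]
            nlinarith [hW n, sq_nonneg c]
      · simp [hj]) T
  simpa [transform_zero, pulls_zero, hW0] using main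

end weights

lemma measureReal_transform_first_le (B : Bandit) (π : Policy) (T : ℕ) (i : Fin 2) (n : ℕ)
    {ε : ℝ} (hε : 0 ≤ ε) {σ : ℝ} (hσ : σ ^ 2 = 1) :
    (law B π T).real {h | n * ε ≤ σ * transform (fun k => if k < n then 1 else 0) i (B.mean i) h T}
      ≤ Real.exp (-(2 * n * ε ^ 2)) := by
  set G : ℕ → ℝ := fun k => if k < n then 1 else 0
  -- The weights vanish after `n` pulls, so W is at most `n` however often the arm is pulled. The
  -- choice c = 4εσ, with c²/8 = 2ε², is optimal in the Chernoff bound.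
  set W : ℕ → ℝ := fun k => ((min k n : ℕ) : ℝ) with hWdef
  have hG : ∀ k, |G k| ≤ 1 := fun k => by simp only [G]; split_ifs <;> simp
  have hW : ∀ k, G k ^ 2 ≤ W (k + 1) - W k := fun k => by
    simp only [G, W]
    split_ifs with h
    · rw [min_eq_left h.le, min_eq_left (Nat.succ_le_of_lt h)]; push_cast; linarith
    · rw [min_eq_right (not_lt.mp h), min_eq_right (by omega)]; simp
  have hW0 : W 0 = 0 := by simp [W]
  have h1 := integral_exp_transform_le hW0 hW hG B π T i (4 * ε * σ)
  set f : Hist T → ℝ := fun h => Real.exp (4 * ε * σ * transform G i (B.mean i) h T -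
    (4 * ε * σ) ^ 2 / 8 * W (pulls (actions h) T i)) with hf
  have hfm : Measurable f := Real.measurable_exp.comp
    (((measurable_transform _ _ _ _).const_mul _).sub
      (measurable_of_actions (fun a => (4 * ε * σ) ^ 2 / 8 * W (pulls a T i))))
  have hfi : Integrable f (law B π T) := by
    refine integrable_of_unitRewards (K := Real.exp (|4 * ε * σ| * T)) hfm fun h hh => ?_
    rw [abs_of_pos (Real.exp_pos _), Real.exp_le_exp]
    have h2 : 4 * ε * σ * transform G i (B.mean i) h T ≤ |4 * ε * σ| * T :=
      (le_abs_self _).trans (by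
        rw [abs_mul]
        exact mul_le_mul_of_nonneg_left (abs_transform_le hG i (mean_mem_Icc B i) hh T)
          (abs_nonneg _))
    have := mul_nonneg (by positivity : 0 ≤ (4 * ε * σ) ^ 2 / 8)
      (weight_nonneg hW0 hW (pulls (actions h) T i))
    linarith
  have h2 := mul_meas_ge_le_integral_of_nonneg (μ := law B π T)
    (Filter.Eventually.of_forall fun h => (Real.exp_pos _).le) hfi (Real.exp (2 * n * ε ^ 2))
  have h3 : (law B π T).real {h | n * ε ≤ σ * transform G i (B.mean i) h T} ≤
      (law B π T).real {h | Real.exp (2 * n * ε ^ 2) ≤ f h} := by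
    refine measureReal_mono fun h hh => ?_
    simp only [Set.mem_ofPred_eq] at hh ⊢
    rw [hf, Real.exp_le_exp]
    have e1 : W (pulls (actions h) T i) ≤ n := by
      simp only [W]; exact_mod_cast min_le_right _ _
    have e2 := mul_le_mul_of_nonneg_left hh (by positivity : 0 ≤ 4 * ε)
    have e3 := mul_le_mul_of_nonneg_left e1 (by positivity : 0 ≤ 2 * ε ^ 2)
    have e4 : (4 * ε * σ) ^ 2 / 8 = 2 * ε ^ 2 := by rw [mul_pow, hσ]; ring
    rw [e4]
    nlinarith
  have h4 : Real.exp (2 * n * ε ^ 2) * (law B π T).real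
      {h | n * ε ≤ σ * transform G i (B.mean i) h T} ≤ 1 :=
    (mul_le_mul_of_nonneg_left h3 (Real.exp_pos _).le).trans (h2.trans h1)
  rw [Real.exp_neg, ← one_div, le_div_iff₀ (Real.exp_pos _), mul_comm]
  exact h4

/-- Hoeffding's inequality for the first `n` rewards of an arm. -/
lemma measureReal_abs_transform_first_le (B : Bandit) (π : Policy) (T : ℕ) (i : Fin 2) (n : ℕ)
    {ε : ℝ} (hε : 0 ≤ ε) :
    (law B π T).real
        {h | n * ε < |transform (fun k => if k < n then 1 else 0) i (B.mean i) h T|}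
      ≤ 2 * Real.exp (-(2 * n * ε ^ 2)) := by
  have h1 := measureReal_transform_first_le B π T i n hε (σ := 1) (by norm_num)
  have h2 := measureReal_transform_first_le B π T i n hε (σ := -1) (by norm_num)
  refine (measureReal_mono (s₂ := {h | n * ε ≤ 1 * transform (fun k => if k < n then 1 else 0) i
      (B.mean i) h T} ∪ {h | n * ε ≤ -1 * transform (fun k => if k < n then 1 else 0) i
      (B.mean i) h T}) ?_).trans ((measureReal_union_le _ _).trans (by linarith))
  intro h hh
  simp only [Set.mem_ofPred_eq, Set.mem_union] at hh ⊢
  rcases lt_abs.mp hh with h3 | h3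
  · left; linarith
  · right; linarith

/-! ### Simultaneous control of sample means without a logarithm -/

/-- The running maximum controlling all sample means after about `ν` pulls. -/
noncomputable def devMax (ν : ℝ) (i : Fin 2) (m : ℝ) {T : ℕ} (h : Hist T) : ℝ :=
  runMax (fun k => 1 / ((k : ℝ) + 1 + ν)) i m h T

lemma devMax_nonneg (ν : ℝ) (i : Fin 2) (m : ℝ) {T : ℕ} (h : Hist T) : 0 ≤ devMax ν i m h :=
  runMax_nonneg _ _ _ _ _

lemma abs_devWeight_le {ν : ℝ} (hν : 0 < ν) (k : ℕ) : |1 / ((k : ℝ) + 1 + ν)| ≤ 1 := by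
  rw [abs_of_nonneg (by positivity), div_le_one (by positivity)]
  have : (0 : ℝ) ≤ k := Nat.cast_nonneg k
  linarith

lemma integrable_devMax {ν : ℝ} (hν : 0 < ν) (B : Bandit) (π : Policy) (T : ℕ) (i : Fin 2) :
    Integrable (fun h => devMax ν i (B.mean i) h) (law B π T) := by
  refine integrable_of_unitRewards (K := T) (measurable_runMax _ _ _ _) fun h hh => ?_
  rw [abs_of_nonneg (devMax_nonneg _ _ _ _)]
  exact runMax_le (abs_devWeight_le hν) i (mean_mem_Icc B i) hh T

lemma integral_devMax_le {ν : ℝ} (hν : 0 < ν) (B : Bandit) (π : Policy) (T : ℕ) (i : Fin 2) :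
    ∫ h, devMax ν i (B.mean i) h ∂(law B π T) ≤ 5 / 2 / Real.sqrt ν := by
  have hG := abs_devWeight_le hν
  -- Telescoping majorant of ∑ 1/(k+1+ν)², bounded by 1/ν uniformly in the horizon.
  set W : ℕ → ℝ := fun k => 1 / ν - 1 / (k + ν) with hWdef
  have hW0 : W 0 = 0 := by simp [W]
  have hW : ∀ k : ℕ, (1 / ((k : ℝ) + 1 + ν)) ^ 2 ≤ W (k + 1) - W k := fun k => by
    simp only [W]
    push_cast
    have hk : (0 : ℝ) ≤ k := Nat.cast_nonneg k
    have e : 1 / ν - 1 / ((k : ℝ) + 1 + ν) - (1 / ν - 1 / (k + ν))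
        = 1 / ((k + ν) * (k + 1 + ν)) := by
      field_simp; ring
    rw [e, div_pow, one_pow]
    apply one_div_le_one_div_of_le (by positivity)
    nlinarith
  have h1 := integral_runMax_sq_le hW0 hW hG B π T i
  have h2 : ∫ h, W (pulls (actions h) T i) ∂(law B π T) ≤ 1 / ν := by
    calc _ ≤ ∫ _, 1 / ν ∂(law B π T) := by
          refine integral_mono ?_ (integrable_const _) fun h => ?_
          · refine integrable_of_unitRewards (K := W T)
              (measurable_of_actions (fun a => W (pulls a T i))) fun h _ => ?_
            rw [abs_of_nonneg (weight_nonneg hW0 hW _)]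
            exact weight_mono hW (pulls_le _ _ _)
          · simp only [W]
            have : 0 ≤ 1 / ((pulls (actions h) T i : ℝ) + ν) := by positivity
            linarith
      _ = 1 / ν := by simp
  have hs : 0 < Real.sqrt ν := Real.sqrt_pos.mpr hν
  have hss : Real.sqrt ν ^ 2 = ν := Real.sq_sqrt hν.le
  have hI2 : Integrable (fun h => runMax (fun k => 1 / ((k : ℝ) + 1 + ν)) i (B.mean i) h T ^ 2)
      (law B π T) := by
    refine integrable_of_unitRewards (K := (T : ℝ) ^ 2) ((measurable_runMax _ _ _ _).pow_const 2)
      fun h hh => ?_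
    rw [abs_of_nonneg (sq_nonneg _)]
    have h1 := runMax_le hG i (mean_mem_Icc B i) hh T
    have h2 := runMax_nonneg (fun k => 1 / ((k : ℝ) + 1 + ν)) i (B.mean i) h T
    gcongr
  calc ∫ h, devMax ν i (B.mean i) h ∂(law B π T)
      ≤ ∫ h, (Real.sqrt ν / 2 * runMax (fun k => 1 / ((k : ℝ) + 1 + ν)) i (B.mean i) h T ^ 2
          + 1 / 2 / Real.sqrt ν) ∂(law B π T) := by
        refine integral_mono (integrable_devMax hν B π T i)
          ((hI2.const_mul _).add (integrable_const _)) fun h => ?_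
        simp only [devMax]
        set A := runMax (fun k => 1 / ((k : ℝ) + 1 + ν)) i (B.mean i) h T
        -- AM-GM passes from the second moment, at most 4/ν, to the first: 2/√ν + 1/(2√ν) =
        -- (5/2)/√ν.
        have e : Real.sqrt ν / 2 * A ^ 2 + 1 / 2 / Real.sqrt ν - A
            = (Real.sqrt ν * A - 1) ^ 2 / (2 * Real.sqrt ν) := by field_simp; ring
        have : 0 ≤ (Real.sqrt ν * A - 1) ^ 2 / (2 * Real.sqrt ν) := by positivity
        linarith
    _ = Real.sqrt ν / 2 * ∫ h, runMax (fun k => 1 / ((k : ℝ) + 1 + ν)) i (B.mean i) h T ^ 2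
          ∂(law B π T) + 1 / 2 / Real.sqrt ν := by
        rw [integral_add (hI2.const_mul _) (integrable_const _), integral_const_mul]
        simp
    _ ≤ Real.sqrt ν / 2 * (4 * (1 / ν)) + 1 / 2 / Real.sqrt ν := by
        gcongr
        linarith
    _ = 5 / 2 / Real.sqrt ν := by
        rw [← hss]; field_simp; rw [Real.sqrt_sq hs.le]; ring

/-- After at least `c ν` pulls the sample mean deviates by at most a multiple of `devMax`. -/
lemma abs_sampleMean_sub_le {ν K : ℝ} (hν : 0 < ν) (i : Fin 2) (m : ℝ) {T : ℕ} (h : Hist T)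
    {n : ℕ} (hn : n ≤ T) (hp : pulls (actions h) n i ≠ 0)
    (hK : ν ≤ K * pulls (actions h) n i) :
    |sampleMean h n i - m| ≤ 2 * (1 + K) * devMax ν i m h := by
  have hp' : (0 : ℝ) < pulls (actions h) n i := by exact_mod_cast Nat.pos_of_ne_zero hp
  rw [sampleMean_sub h n i m hp, abs_div, abs_of_pos hp', div_le_iff₀ hp']
  refine (abs_transform_one_le hν i m h hn).trans ?_
  change _ * devMax ν i m h ≤ _
  have hA := devMax_nonneg ν i m h
  nlinarith [mul_le_mul_of_nonneg_right hK hA]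

/-! ### Regret decomposition -/

lemma Bandit.gap_one {B : Bandit} (hB : B.mean 1 < B.mean 0) : B.gap 1 = B.mean 0 - B.mean 1 := by
  rw [Bandit.gap, Bandit.bestMean, max_eq_left hB.le]

lemma integrable_pulls (B : Bandit) (π : Policy) (T n : ℕ) (i : Fin 2) :
    Integrable (fun h : Hist T => (pulls (actions h) n i : ℝ)) (law B π T) :=
  integrable_of_unitRewards (K := T) (measurable_of_actions (fun a => (pulls a n i : ℝ)))
    fun h _ => by
      rw [abs_of_nonneg (Nat.cast_nonneg _)]
      exact_mod_cast pulls_le _ _ _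

/-- The regret is the gap times the expected number of pulls of the worse arm. -/
lemma regret_eq {B : Bandit} (hB : B.mean 1 < B.mean 0) (π : Policy) (T : ℕ) :
    regret B π T = B.gap 1 * ∫ h, (pulls (actions h) T 1 : ℝ) ∂(law B π T) := by
  -- The total reward is two centred transforms, of mean zero, plus the means of the pulled arms.
  have key : ∀ h : Hist T, ∑ s, (h s).2 = transform (fun _ => 1) 0 (B.mean 0) h T
      + transform (fun _ => 1) 1 (B.mean 1) h T
      + (T * B.mean 0 - B.gap 1 * pulls (actions h) T 1) := by
    intro h
    have h1 := pulls_add le_rfl (actions h)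
    have h2 : (T : ℝ) = pulls (actions h) T 0 + pulls (actions h) T 1 := by
      exact_mod_cast h1.symm
    have h3 : (T * B.mean 0 - B.gap 1 * pulls (actions h) T 1)
        = pulls (actions h) T 0 * B.mean 0 + pulls (actions h) T 1 * B.mean 1 := by
      rw [Bandit.gap_one hB, h2]; ring
    rw [h3, cast_pulls, cast_pulls, transform, transform, Finset.sum_mul, Finset.sum_mul,
      ← Finset.sum_add_distrib, ← Finset.sum_add_distrib, ← Finset.sum_add_distrib]
    refine Finset.sum_congr rfl fun s _ => ?_
    have h4 : (h s).1 = 0 ∨ (h s).1 = 1 := by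
      have : ∀ j : Fin 2, j = 0 ∨ j = 1 := by decide
      exact this _
    rcases h4 with h4 | h4 <;> simp [h4, actions, s.2]
  have hI : ∀ i, Integrable (fun h => transform (fun _ => 1) i (B.mean i) h T) (law B π T) :=
    fun i => integrable_of_unitRewards (measurable_transform _ _ _ _) (K := T) fun h hh =>
      abs_transform_le (by simp) i (mean_mem_Icc B i) hh T
  have hIp := integrable_pulls B π T T 1
  have hI1 : Integrable (fun h => transform (fun _ => 1) 0 (B.mean 0) h T
      + transform (fun _ => 1) 1 (B.mean 1) h T) (law B π T) := (hI 0).add (hI 1)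
  have hI2 : Integrable (fun h => T * B.mean 0 - B.gap 1 * pulls (actions h) T 1) (law B π T) :=
    (integrable_const _).sub (hIp.const_mul _)
  rw [regret]
  simp only [key]
  rw [integral_add hI1 hI2, integral_add (hI 0) (hI 1), integral_transform B π T 0 (by simp),
    integral_transform B π T 1 (by simp), integral_sub (integrable_const _) (hIp.const_mul _),
    integral_const_mul (B.gap 1), Bandit.bestMean, max_eq_left hB.le]
  simp

/-! ### The confidence width -/

/-- This is e^x ≥ 1 + x at x = α log T. It makes concentration proved for α = 0 available for every
α. -/
lemma log_le_scale {α : ℝ} (hα : 0 ≤ α) {T : ℕ} (hT : 2 ≤ T) : Real.log T ≤ scale α T := by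
  unfold scale
  split_ifs with h
  · exact le_rfl
  · have hα' : 0 < α := lt_of_le_of_ne hα (Ne.symm h)
    have hT' : (0 : ℝ) < T := by positivity
    rw [le_div_iff₀ hα', Real.rpow_def_of_pos hT']
    linarith [Real.add_one_le_exp (Real.log T * α)]

lemma half_le_scale {α : ℝ} (hα : 0 ≤ α) {T : ℕ} (hT : 2 ≤ T) : 1 / 2 ≤ scale α T := by
  have h1 := log_le_scale hα hT
  have h2 : Real.log 2 ≤ Real.log T := Real.log_le_log (by norm_num) (by exact_mod_cast hT)
  linarith [Real.log_two_gt_d9]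

lemma width_nonneg (α : ℝ) (T n : ℕ) : 0 ≤ width α T n := Real.sqrt_nonneg _

lemma width_sq {α : ℝ} {T : ℕ} (hL : 0 ≤ scale α T) (n : ℕ) :
    width α T n ^ 2 = 2 * scale α T / n := Real.sq_sqrt (by positivity)

/-- A value by convention, from division by zero, not the infinite width of an unpulled arm. Hence
`width_anti` excludes zero pulls, while the crude bound by `width α T 1` does not. -/
lemma width_zero (α : ℝ) (T : ℕ) : width α T 0 = 0 := by simp [width]

lemma width_pos {α : ℝ} {T : ℕ} (hL : 0 < scale α T) {n : ℕ} (hn : n ≠ 0) : 0 < width α T n :=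
  Real.sqrt_pos.mpr (by have : (0 : ℝ) < n := by exact_mod_cast Nat.pos_of_ne_zero hn
                        positivity)

lemma width_anti {α : ℝ} {T : ℕ} (hL : 0 ≤ scale α T) {m n : ℕ} (hm : m ≠ 0) (h : m ≤ n) :
    width α T n ≤ width α T m := by
  apply Real.sqrt_le_sqrt
  have : (0 : ℝ) < m := by exact_mod_cast Nat.pos_of_ne_zero hm
  have h' : (m : ℝ) ≤ n := by exact_mod_cast h
  gcongr

lemma width_le_width_one {α : ℝ} {T : ℕ} (hL : 0 ≤ scale α T) (n : ℕ) :
    width α T n ≤ width α T 1 := by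
  rcases Nat.eq_zero_or_pos n with rfl | hn
  · rw [width_zero]; exact width_nonneg _ _ _
  · exact width_anti hL one_ne_zero hn

/-- A lower bound on the width bounds the number of pulls from above. -/
lemma le_of_le_mul_width {α Δ c : ℝ} {T n : ℕ} (hL : 0 ≤ scale α T) (hΔ : 0 < Δ)
    (hn : n ≠ 0) (h : Δ ≤ c * width α T n) : n ≤ 2 * c ^ 2 * (scale α T / Δ ^ 2) := by
  have hn' : (0 : ℝ) < n := by exact_mod_cast Nat.pos_of_ne_zero hn
  have h1 : Δ ^ 2 ≤ c ^ 2 * (2 * scale α T / n) := by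
    rw [← width_sq hL n, ← mul_pow]; gcongr
  rw [mul_div_assoc', le_div_iff₀ hn'] at h1
  rw [mul_div_assoc', le_div_iff₀ (by positivity)]
  linarith

/-- An upper bound on the width bounds the number of pulls from below. -/
lemma le_of_mul_width_le {α Δ c : ℝ} {T n : ℕ} (hL : 0 ≤ scale α T) (hΔ : 0 < Δ)
    (hn : n ≠ 0) (h : width α T n ≤ c * Δ) : 2 * (scale α T / Δ ^ 2) ≤ c ^ 2 * n := by
  have hn' : (0 : ℝ) < n := by exact_mod_cast Nat.pos_of_ne_zero hn
  have hw := width_nonneg α T n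
  have h1 : 2 * scale α T / n ≤ c ^ 2 * Δ ^ 2 := by
    rw [← width_sq hL n, ← mul_pow]; gcongr
  rw [div_le_iff₀ hn'] at h1
  rw [mul_div_assoc', div_le_iff₀ (by positivity)]
  linarith

/-- Put a = C(k) and b = C(k+1). From a²k = b²(k+1) follows (a - b)k(a + b) = b² ≤ a², hence (a -
b)k ≤ a. -/
lemma width_sub_width_succ_le {α : ℝ} {T k : ℕ} (hL : 0 ≤ scale α T) (hk : k ≠ 0) :
    width α T k - width α T (k + 1) ≤ width α T k / k := by
  have hk' : (0 : ℝ) < k := by exact_mod_cast Nat.pos_of_ne_zero hk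
  have h1 := width_sq (α := α) (T := T) hL k
  have h2 := width_sq (α := α) (T := T) hL (k + 1)
  have h3 := width_nonneg α T (k + 1)
  have h4 := width_nonneg α T k
  rw [eq_div_iff (by positivity)] at h1 h2
  push_cast at h2
  rw [le_div_iff₀ hk']
  have h5 : width α T (k + 1) ≤ width α T k := width_anti hL hk (Nat.le_succ k)
  rcases h4.eq_or_lt with h6 | h6
  · rw [← h6] at h5 ⊢
    rw [le_antisymm h5 h3]
    simp
  · have h7 : (width α T k - width α T (k + 1)) * k * width α T k ≤
        width α T k * width α T k := by
      nlinarith [mul_nonneg (mul_nonneg h3 (sub_nonneg.mpr h5)) hk'.le]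
    exact le_of_mul_le_mul_right h7 h6

/-- Consecutive widths differ by at most the statistical error. -/
lemma width_sub_width_succ_le_of_le {α Δ c K : ℝ} {T k : ℕ} (hL : 1 / 2 ≤ scale α T) (hΔ : 0 < Δ)
    (hΔ1 : Δ ≤ 1) (hc : 0 ≤ c) (hk : k ≠ 0) (hw : width α T k ≤ c * Δ)
    (hkK : scale α T / Δ ^ 2 ≤ K * k) :
    width α T k - width α T (k + 1) ≤ 2 * c * K / Real.sqrt (scale α T / Δ ^ 2) := by
  have hk' : (0 : ℝ) < k := by exact_mod_cast Nat.pos_of_ne_zero hk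
  refine (width_sub_width_succ_le (by linarith) hk).trans ?_
  set ν := scale α T / Δ ^ 2 with hν
  have hν1 : 1 / 2 ≤ ν := by
    rw [hν, le_div_iff₀ (by positivity)]
    nlinarith [pow_le_one₀ hΔ.le hΔ1 (n := 2)]
  have hs : 0 < Real.sqrt ν := Real.sqrt_pos.mpr (by linarith)
  have hss : Real.sqrt ν * Real.sqrt ν = ν := Real.mul_self_sqrt (by linarith)
  have hs1 : 1 / 2 ≤ Real.sqrt ν := by
    rw [Real.le_sqrt' (by norm_num)]; linarith
  have hw1 : width α T k ≤ c := hw.trans (by nlinarith)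
  rw [div_le_div_iff₀ hk' hs]
  have h1 : width α T k * Real.sqrt ν ≤ c * Real.sqrt ν := by gcongr
  -- Since √ν ≥ 1/2, √ν is at most 2ν.
  have h2 : Real.sqrt ν ≤ 2 * (K * k) := by nlinarith
  nlinarith [mul_le_mul_of_nonneg_left h2 hc]

lemma gap_pos {B : Bandit} (hB : B.mean 1 < B.mean 0) : 0 < B.gap 1 := by
  rw [Bandit.gap_one hB]; linarith

lemma gap_le_one (B : Bandit) : B.gap 1 ≤ 1 := by
  rw [Bandit.gap, Bandit.bestMean]
  have := max_le (mean_mem_Icc B 0).2 (mean_mem_Icc B 1).2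
  linarith [(mean_mem_Icc B 1).1]

lemma half_le_scale_div {α : ℝ} (hα : 0 ≤ α) {T : ℕ} (hT : 2 ≤ T) {B : Bandit}
    (hB : B.mean 1 < B.mean 0) : 1 / 2 ≤ scale α T / B.gap 1 ^ 2 := by
  have h1 := half_le_scale hα hT
  have h2 := gap_pos hB
  rw [le_div_iff₀ (by positivity)]
  nlinarith [pow_le_one₀ h2.le (gap_le_one B) (n := 2)]

/-! ### Concentration of all sample means -/

/-- All sample means lie within three quarters of the confidence width of the means. -/
def Concentrated (B : Bandit) (α : ℝ) {T : ℕ} (h : Hist T) : Prop :=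
  ∀ i t, t ≤ T → pulls (actions h) t i ≠ 0 →
    |sampleMean h t i - B.mean i| ≤ 3 / 4 * width α T (pulls (actions h) t i)

/-- A measurable set of small probability outside which all sample means are concentrated. -/
def deviantSet (B : Bandit) (α : ℝ) (T : ℕ) : Set (Hist T) :=
  ⋃ p ∈ (Finset.univ : Finset (Fin 2)) ×ˢ Finset.Icc 1 T,
    {h | p.2 * (3 / 4 * width α T p.2) <
      |transform (fun k => if k < p.2 then 1 else 0) p.1 (B.mean p.1) h T|}

lemma measurableSet_deviantSet (B : Bandit) (α : ℝ) (T : ℕ) :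
    MeasurableSet (deviantSet B α T) :=
  Finset.measurableSet_biUnion _ fun _ _ =>
    measurableSet_lt measurable_const (measurable_transform _ _ _ _).norm

/-- The union runs over deterministic pull counts n: the deviation at a random time depends only on
the first n rewards of the arm, by `transform_first`. -/
lemma concentrated_of_notMem {B : Bandit} {α : ℝ} {T : ℕ} {h : Hist T}
    (hh : h ∉ deviantSet B α T) : Concentrated B α h := by
  intro i t ht hp
  set n := pulls (actions h) t i with hn
  have hp' : (0 : ℝ) < n := by exact_mod_cast Nat.pos_of_ne_zero hp
  by_contra hcon
  push Not at hcon
  refine hh (Set.mem_biUnion (x := (i, n)) ?_ ?_)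
  · simp only [Finset.coe_product, Set.mem_prod, Finset.coe_univ, Set.mem_univ, true_and,
      Finset.coe_Icc, Set.mem_Icc]
    exact ⟨Nat.pos_of_ne_zero hp, pulls_le _ _ _⟩
  · simp only [Set.mem_ofPred_eq]
    rw [hn, transform_first, ← hn]
    rw [sampleMean_sub h t i _ hp, abs_div, abs_of_pos hp', lt_div_iff₀ hp'] at hcon
    linarith

lemma measureReal_deviantSet_le (B : Bandit) (π : Policy) {α : ℝ} (hα : 0 ≤ α) {T : ℕ}
    (hT : 2 ≤ T) : (law B π T).real (deviantSet B α T) ≤ 4 / T := by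
  have hL := half_le_scale hα hT
  have hT' : (0 : ℝ) < T := by positivity
  have h1 : ∀ p ∈ (Finset.univ : Finset (Fin 2)) ×ˢ Finset.Icc 1 T,
      (law B π T).real {h | p.2 * (3 / 4 * width α T p.2) <
      |transform (fun k => if k < p.2 then 1 else 0) p.1 (B.mean p.1) h T|} ≤ 2 / (T : ℝ) ^ 2 := by
    rintro ⟨i, n⟩ hp
    simp only [Finset.mem_product, Finset.mem_Icc] at hp
    have hn : (0 : ℝ) < n := by exact_mod_cast hp.2.1
    have hw := width_nonneg α T n
    refine (measureReal_abs_transform_first_le B π T i n (by positivity)).trans ?_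
    rw [mul_pow, width_sq (by linarith)]
    -- The factor 3/4 gives exponent 9/4 · L ≥ 2 log T, enough for the union over 2T pairs, while
    -- remaining below 1, as elimination requires.
    have e : 2 * (n : ℝ) * ((3 / 4) ^ 2 * (2 * scale α T / n)) = 9 / 4 * scale α T := by
      field_simp; norm_num
    rw [e]
    have h2 : Real.exp (-(9 / 4 * scale α T)) ≤ Real.exp (-(2 * Real.log T)) := by
      rw [Real.exp_le_exp]
      linarith [log_le_scale hα hT]
    have h3 : Real.exp (-(2 * Real.log T)) = 1 / (T : ℝ) ^ 2 := by
      rw [Real.exp_neg, two_mul, Real.exp_add, Real.exp_log hT', one_div, sq]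
    rw [h3] at h2
    calc _ ≤ 2 * (1 / (T : ℝ) ^ 2) := by gcongr
      _ = _ := by ring
  refine (measureReal_biUnion_finset_le _ _).trans ((Finset.sum_le_sum h1).trans ?_)
  rw [Finset.sum_const, Finset.card_product]
  simp only [Finset.card_univ, Fintype.card_fin, Nat.card_Icc, nsmul_eq_mul]
  push_cast
  apply le_of_eq
  field_simp
  norm_num

/-! ### From bounds on the concentration event to the error of the estimator -/

/-- Common end of both upper bounds. The error is O(1/√ν) in mean, because `devMax` is and because
the bad event has probability at most 4/T. The expected number of bad pulls is at most (K + 8)ν, so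
1/√ν is at most a multiple of √(Δ / R). -/
lemma estError_le_of_concentrated {B : Bandit} (hB : B.mean 1 < B.mean 0) (π : Policy) {α : ℝ}
    (hα : 0 ≤ α) {T : ℕ} (hT : 2 ≤ T) (hTL : 64 * (scale α T / B.gap 1 ^ 2) ≤ T)
    (est : ℝ → (Fin T → Fin 2) → ℝ) {K : ℝ} (hK : 0 ≤ K)
    (hall : ∀ a, |est B.bestMean a - B.mean 1| ≤ 1 + Real.sqrt T)
    (hgood : ∀ᵐ h ∂(law B π T), Concentrated B α h →
      |est B.bestMean (actions h) - B.mean 1| ≤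
        K * (devMax (scale α T / B.gap 1 ^ 2) 0 (B.mean 0) h
          + devMax (scale α T / B.gap 1 ^ 2) 1 (B.mean 1) h)
        + K / Real.sqrt (scale α T / B.gap 1 ^ 2) ∧
      1 ≤ pulls (actions h) T 1 ∧ pulls (actions h) T 1 ≤ K * (scale α T / B.gap 1 ^ 2)) :
    estError B π T 1 est
      ≤ (6 * K + 1) * Real.sqrt (K + 8) * Real.sqrt (B.gap 1 / regret B π T) := by
  have hν1 := half_le_scale_div hα hT hB
  set ν := scale α T / B.gap 1 ^ 2
  have hν : 0 < ν := by linarith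
  have hΔ := gap_pos hB
  have hT' : (0 : ℝ) < T := by positivity
  have hs : 0 < Real.sqrt ν := Real.sqrt_pos.mpr hν
  have hsT : 0 < Real.sqrt T := Real.sqrt_pos.mpr hT'
  set D := deviantSet B α T
  have hD := measurableSet_deviantSet B α T
  have hDm := measureReal_deviantSet_le B π hα hT
  have hID : Integrable (D.indicator fun _ => (1 : ℝ)) (law B π T) :=
    (integrable_const _).indicator hD
  have hIDe : ∫ h, D.indicator (fun _ => (1 : ℝ)) h ∂(law B π T) = (law B π T).real D :=
    integral_indicator_one hD
  have hI0 := integrable_devMax hν B π T 0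
  have hI1 := integrable_devMax hν B π T 1
  have hest : estError B π T 1 est ≤ (6 * K + 1) / Real.sqrt ν := by
    have hIs : Integrable (fun h => K * (devMax ν 0 (B.mean 0) h + devMax ν 1 (B.mean 1) h))
      (law B π T) := (hI0.add hI1).const_mul K
    calc estError B π T 1 est
        ≤ ∫ h, ((K * (devMax ν 0 (B.mean 0) h + devMax ν 1 (B.mean 1) h) + K / Real.sqrt ν)
            + (1 + Real.sqrt T) * D.indicator (fun _ => (1 : ℝ)) h) ∂(law B π T) := by
          refine integral_mono_ae ?_ ?_ ?_
          · exact integrable_of_unitRewards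
              (measurable_of_actions (fun a => |est B.bestMean a - B.mean 1|))
              fun h _ => by rw [abs_abs]; exact hall _
          · exact (hIs.add (integrable_const _)).add (hID.const_mul _)
          · filter_upwards [hgood] with h hh
            have h0 := devMax_nonneg ν 0 (B.mean 0) h
            have h1 := devMax_nonneg ν 1 (B.mean 1) h
            by_cases hmem : h ∈ D
            · rw [Set.indicator_of_mem hmem]
              have := hall (actions h)
              have h2 : 0 ≤ K * (devMax ν 0 (B.mean 0) h + devMax ν 1 (B.mean 1) h)
                + K / Real.sqrt ν := by positivity
              linarith
            · rw [Set.indicator_of_notMem hmem, mul_zero, add_zero]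
              exact (hh (concentrated_of_notMem hmem)).1
      _ = K * (∫ h, devMax ν 0 (B.mean 0) h ∂(law B π T)
            + ∫ h, devMax ν 1 (B.mean 1) h ∂(law B π T)) + K / Real.sqrt ν
            + (1 + Real.sqrt T) * (law B π T).real D := by
          have hIs' : Integrable (fun h => K * (devMax ν 0 (B.mean 0) h + devMax ν 1 (B.mean 1) h)
              + K / Real.sqrt ν) (law B π T) := hIs.add (integrable_const _)
          rw [integral_add hIs' (hID.const_mul _),
            integral_add hIs (integrable_const _), integral_const_mul K, integral_const_mul (1 + √_),
            integral_add hI0 hI1, hIDe]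
          simp
      _ ≤ K * (5 / 2 / Real.sqrt ν + 5 / 2 / Real.sqrt ν) + K / Real.sqrt ν
            + (1 + Real.sqrt T) * (4 / T) := by
          gcongr
          · exact integral_devMax_le hν B π T 0
          · exact integral_devMax_le hν B π T 1
      _ ≤ K * (5 / 2 / Real.sqrt ν + 5 / 2 / Real.sqrt ν) + K / Real.sqrt ν
            + 1 / Real.sqrt ν := by
          gcongr
          -- The bad event costs (1 + √T) · 4/T ≤ 8/√T, and T ≥ 64ν makes this at most 1/√ν.
          have h8 : 8 * Real.sqrt ν ≤ Real.sqrt T := by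
            apply Real.le_sqrt_of_sq_le
            rw [mul_pow, Real.sq_sqrt hν.le]
            linarith
          have hTs : Real.sqrt T * Real.sqrt T = T := Real.mul_self_sqrt hT'.le
          have hT1 : 1 ≤ Real.sqrt T := by
            rw [Real.one_le_sqrt]; exact_mod_cast (by omega : 1 ≤ T)
          rw [mul_div_assoc', div_le_div_iff₀ hT' hs]
          nlinarith
      _ = (6 * K + 1) / Real.sqrt ν := by ring
  set E := ∫ h, (pulls (actions h) T 1 : ℝ) ∂(law B π T)
  have hIp := integrable_pulls B π T T 1
  have hEle : E ≤ (K + 8) * ν := by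
    calc E ≤ ∫ h, (K * ν + T * D.indicator (fun _ => (1 : ℝ)) h) ∂(law B π T) := by
          refine integral_mono_ae hIp ((integrable_const _).add (hID.const_mul _)) ?_
          filter_upwards [hgood] with h hh
          by_cases hmem : h ∈ D
          · rw [Set.indicator_of_mem hmem]
            have : (pulls (actions h) T 1 : ℝ) ≤ T := by exact_mod_cast pulls_le _ _ _
            nlinarith
          · rw [Set.indicator_of_notMem hmem, mul_zero, add_zero]
            exact (hh (concentrated_of_notMem hmem)).2.2
      _ = K * ν + T * (law B π T).real D := by
          rw [integral_add (integrable_const _) (hID.const_mul _), integral_const_mul (T : ℝ), hIDe]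
          simp
      _ ≤ K * ν + T * (4 / T) := by gcongr
      _ ≤ (K + 8) * ν := by
          rw [mul_div_cancel₀ _ hT'.ne']
          linarith
  -- Positivity matters: at zero regret the right-hand side would be 0 by the convention for
  -- division.
  have hEpos : 0 < E := by
    have hT44 : (32 : ℝ) ≤ T := by linarith
    have h1 : ∫ h, (1 - D.indicator (fun _ => (1 : ℝ)) h) ∂(law B π T) ≤ E := by
      refine integral_mono_ae ((integrable_const _).sub hID) hIp ?_
      filter_upwards [hgood] with h hh
      by_cases hmem : h ∈ D
      · rw [Set.indicator_of_mem hmem, sub_self]; positivity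
      · rw [Set.indicator_of_notMem hmem, sub_zero]
        exact_mod_cast (hh (concentrated_of_notMem hmem)).2.1
    rw [integral_sub (integrable_const _) hID, hIDe] at h1
    have h2 : 4 / (T : ℝ) ≤ 1 / 8 := by
      rw [div_le_div_iff₀ hT' (by norm_num)]; linarith
    simp only [integral_const, probReal_univ, smul_eq_mul] at h1
    linarith
  rw [regret_eq hB]
  change _ ≤ _ * Real.sqrt (B.gap 1 / (B.gap 1 * E))
  have e : B.gap 1 / (B.gap 1 * E) = 1 / E := by field_simp
  rw [e]
  refine hest.trans ?_
  have h3 : 1 / ((K + 8) * ν) ≤ 1 / E := one_div_le_one_div_of_le hEpos hEle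
  have h4 := Real.sqrt_le_sqrt h3
  rw [Real.sqrt_div zero_le_one, Real.sqrt_one, Real.sqrt_mul (by linarith)] at h4
  have h5 : 0 < Real.sqrt (K + 8) := Real.sqrt_pos.mpr (by linarith)
  calc (6 * K + 1) / Real.sqrt ν
      = (6 * K + 1) * Real.sqrt (K + 8) * (1 / (Real.sqrt (K + 8) * Real.sqrt ν)) := by
        field_simp
    _ ≤ _ := by gcongr

/-! ### Locating pulls -/

lemma arm_cases (i : Fin 2) : i = 0 ∨ i = 1 := by
  revert i; decide

lemma exists_of_pulls_lt {t : ℕ} (a : Fin t → Fin 2) (i : Fin 2) {m n : ℕ} (hn : n ≤ t)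
    (h : pulls a m i < pulls a n i) : ∃ s, ∃ hs : s < t, m ≤ s ∧ s < n ∧ a ⟨s, hs⟩ = i := by
  induction n with
  | zero => simp [pulls_zero] at h
  | succ n ih =>
    by_cases hi : a ⟨n, hn⟩ = i
    · refine ⟨n, hn, ?_, Nat.lt_succ_self n, hi⟩
      by_contra hlt
      exact absurd (pulls_mono a i (show n + 1 ≤ m by omega)) (by omega)
    · rw [pulls_succ hn, if_neg hi, add_zero] at h
      obtain ⟨s, hs, h1, h2, h3⟩ := ih (by omega) h
      exact ⟨s, hs, h1, by omega, h3⟩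

lemma pulls_eq_of_forall_ne {t : ℕ} (a : Fin t → Fin 2) (i : Fin 2) {m n : ℕ} (hn : n ≤ t)
    (hmn : m ≤ n) (h : ∀ s (hs : s < t), m ≤ s → s < n → a ⟨s, hs⟩ ≠ i) :
    pulls a n i = pulls a m i := by
  refine le_antisymm ?_ (pulls_mono a i hmn)
  by_contra hlt
  obtain ⟨s, hs, h1, h2, h3⟩ := exists_of_pulls_lt a i hn (not_le.mp hlt)
  exact h s hs h1 h2 h3

lemma exists_last_pull {t : ℕ} (a : Fin t → Fin 2) (i : Fin 2) (h : pulls a t i ≠ 0) :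
    ∃ s, ∃ hs : s < t, a ⟨s, hs⟩ = i ∧ (∀ s' (hs' : s' < t), s < s' → a ⟨s', hs'⟩ ≠ i) ∧
      pulls a (s + 1) i = pulls a t i := by
  have h1 : pulls a 0 i < pulls a t i := by rw [pulls_zero]; omega
  obtain ⟨s0, hs0, -, -, h2⟩ := exists_of_pulls_lt a i le_rfl h1
  obtain ⟨s, hs, hmax⟩ := Finset.exists_max_image (Finset.univ.filter fun s : Fin t => a s = i)
    (fun s => s.val) ⟨⟨s0, hs0⟩, by simpa using h2⟩
  simp only [Finset.mem_filter, Finset.mem_univ, true_and] at hs hmax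
  have h3 : ∀ s' (hs' : s' < t), s.val < s' → a ⟨s', hs'⟩ ≠ i := fun s' hs' hlt he =>
    absurd (hmax _ he) (by simpa using hlt)
  refine ⟨s.1, s.2, hs, h3, ?_⟩
  exact (pulls_eq_of_forall_ne a i le_rfl s.2 fun s' hs' hle _ => h3 s' hs' hle).symm

lemma width_le_mul {α Δ c : ℝ} {T n : ℕ} (hΔ : 0 < Δ) (hc : 0 ≤ c)
    (h : 2 * (scale α T / Δ ^ 2) ≤ c ^ 2 * n) : width α T n ≤ c * Δ := by
  rcases Nat.eq_zero_or_pos n with rfl | hn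
  · rw [width_zero]; positivity
  have hn' : (0 : ℝ) < n := by exact_mod_cast hn
  apply Real.sqrt_le_iff.mpr ⟨by positivity, ?_⟩
  rw [mul_div_assoc', div_le_iff₀ (by positivity)] at h
  rw [div_le_iff₀ hn']
  linarith

/-- Worst case over all action sequences: (2C(1))² = 8L ≤ 64ν ≤ T. It bounds the estimators off the
concentration event. -/
lemma two_mul_width_le {α Δ : ℝ} (hα : 0 ≤ α) {T : ℕ} (hT : 2 ≤ T) (hΔ : 0 < Δ) (hΔ1 : Δ ≤ 1)
    (hTL : 64 * (scale α T / Δ ^ 2) ≤ T) (n : ℕ) : 2 * width α T n ≤ Real.sqrt T := by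
  have hL := half_le_scale hα hT
  have h1 := width_le_width_one (α := α) (T := T) (by linarith) n
  have h2 : 2 * width α T 1 ≤ Real.sqrt T := by
    apply Real.le_sqrt_of_sq_le
    rw [mul_pow, width_sq (by linarith)]
    have h3 : scale α T ≤ scale α T / Δ ^ 2 := by
      rw [le_div_iff₀ (by positivity)]
      nlinarith [pow_le_one₀ hΔ.le hΔ1 (n := 2)]
    push_cast
    linarith
  linarith

/-! ### The upper confidence bound algorithm -/

lemma measurableSet_ucbAllowed (α : ℝ) (T t : ℕ) (i : Fin 2) :
    MeasurableSet {h : Hist t | i ∈ ucbAllowed α T h} := by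
  have hp : ∀ j, MeasurableSet {h : Hist t | pulls (actions h) t j = 0} := fun j =>
    measurableSet_eq_fun (measurable_pulls t j) measurable_const
  have hm : ∀ j, Measurable fun h : Hist t =>
      sampleMean h t j + width α T (pulls (actions h) t j) := fun j =>
    (measurable_sampleMean t j).add (measurable_of_actions (fun a => width α T (pulls a t j)))
  have e : {h : Hist t | i ∈ ucbAllowed α T h} = {h | pulls (actions h) t i = 0} ∪
      ⋂ j, ({h | pulls (actions h) t j = 0}ᶜ ∩
        {h | sampleMean h t j + width α T (pulls (actions h) t j) ≤
          sampleMean h t i + width α T (pulls (actions h) t i)}) := by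
    ext h; simp [ucbAllowed]
  rw [e]
  exact (hp i).union (MeasurableSet.iInter fun j =>
    (hp j).compl.inter (measurableSet_le (hm j) (hm i)))

/-- Every round of the history follows the upper confidence bound rule. -/
def FollowsUCB (α : ℝ) {T : ℕ} (h : Hist T) : Prop :=
  ∀ t (ht : t < T) i, actions h ⟨t, ht⟩ = i → pulls (actions h) t i = 0 ∨
    ∀ j, pulls (actions h) t j ≠ 0 ∧
      sampleMean h t j + width α T (pulls (actions h) t j) ≤
        sampleMean h t i + width α T (pulls (actions h) t i)

lemma ae_followsUCB (B : Bandit) {π : Policy} {α : ℝ} {T : ℕ} (hπ : IsUCB α T π) :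
    ∀ᵐ h ∂(law B π T), FollowsUCB α h := by
  filter_upwards [ae_allowed B π T (fun t h => ucbAllowed α T h)
    (fun t i => measurableSet_ucbAllowed α T t i) hπ] with h hh
  rintro t ht i rfl
  have := hh t ht
  simp only [ucbAllowed, Set.mem_ofPred_eq, pulls_restr ht.le le_rfl,
    sampleMean_restr ht.le le_rfl] at this
  exact this

section UCB

variable {B : Bandit} {α : ℝ} {T : ℕ} {h : Hist T}

/-- An already pulled arm may be pulled again only once every arm has been pulled, so the first two
rounds pull different arms. -/
lemma FollowsUCB.pulls_two (hu : FollowsUCB α h) (hT : 2 ≤ T) :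
    pulls (actions h) 2 1 ≠ 0 := by
  intro h0
  have h1 : pulls (actions h) 1 1 = 0 := by
    have := pulls_mono (actions h) 1 (show 1 ≤ 2 by norm_num); omega
  have h2 := pulls_add (show 1 ≤ T by omega) (actions h)
  have h3 : actions h ⟨1, by omega⟩ = 0 := by
    rcases arm_cases (actions h ⟨1, by omega⟩) with h4 | h4
    · exact h4
    · rw [pulls_succ (show 1 < T by omega), if_pos h4] at h0; omega
  rcases hu 1 (by omega) 0 h3 with h4 | h4
  · omega
  · exact (h4 1).1 h1

/-- When the worse arm is chosen by its index, concentration gives Δ ≤ (1 + 3/4) C(n) with n its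
pulls so far, so n ≤ 49/8 · ν just before each such pull. -/
lemma FollowsUCB.pulls_one_le (hu : FollowsUCB α h) (hc : Concentrated B α h)
    (hB : B.mean 1 < B.mean 0) (hL : 0 ≤ scale α T) {t : ℕ} (ht : t ≤ T) :
    (pulls (actions h) t 1 : ℝ) ≤ 1 + 49 / 8 * (scale α T / B.gap 1 ^ 2) := by
  have hΔ := gap_pos hB
  have hν : 0 ≤ scale α T / B.gap 1 ^ 2 := by positivity
  induction t with
  | zero => rw [pulls_zero]; push_cast; linarith
  | succ t ih =>
    rw [pulls_succ ht]
    split_ifs with hi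
    · rcases hu t ht 1 hi with h0 | h1
      · rw [h0]; push_cast; linarith
      · have h2 := abs_le.mp (hc 0 t (by omega) (h1 0).1)
        have h3 := abs_le.mp (hc 1 t (by omega) (h1 1).1)
        have h4 := (h1 0).2
        have h5 := width_nonneg α T (pulls (actions h) t 0)
        have h6 : B.gap 1 ≤ 7 / 4 * width α T (pulls (actions h) t 1) := by
          rw [Bandit.gap_one hB]; linarith
        have h7 := le_of_le_mul_width hL hΔ (h1 1).1 h6
        push_cast
        linarith
    · exact ih (by omega)

/-- At the switching round s the worse arm wins with k pulls, and in the next round the better arm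
wins against k + 1 pulls. These two index comparisons bracket C(k+1) - C(n₁) around Δ; the work is
to show that k and n₁ are at least of order ν. -/
lemma FollowsUCB.estimate (hu : FollowsUCB α h) (hc : Concentrated B α h)
    (hB : B.mean 1 < B.mean 0) (hα : 0 ≤ α) (hT : 2 ≤ T)
    (hTL : 64 * (scale α T / B.gap 1 ^ 2) ≤ T)
    {best : (Fin T → Fin 2) → Fin 2} (hbest : IsMostPulled best) :
    |ucbEstimate α best B.bestMean (actions h) 1 - B.mean 1| ≤
      4000 * (devMax (scale α T / B.gap 1 ^ 2) 0 (B.mean 0) h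
        + devMax (scale α T / B.gap 1 ^ 2) 1 (B.mean 1) h)
      + 4000 / Real.sqrt (scale α T / B.gap 1 ^ 2) := by
  have hL2 := half_le_scale hα hT
  have hL : 0 ≤ scale α T := by linarith
  have hΔ := gap_pos hB
  have hΔ1 := gap_le_one B
  have hν1 := half_le_scale_div hα hT hB
  have hlog : 69 / 100 ≤ scale α T / B.gap 1 ^ 2 := by
    have h1 := log_le_scale hα hT
    have h2 : Real.log 2 ≤ Real.log T := Real.log_le_log (by norm_num) (by exact_mod_cast hT)
    have h3 : scale α T ≤ scale α T / B.gap 1 ^ 2 := by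
      rw [le_div_iff₀ (by positivity)]
      nlinarith [pow_le_one₀ hΔ.le hΔ1 (n := 2)]
    linarith [Real.log_two_gt_d9]
  have hg := Bandit.gap_one hB
  have hp1 := fun {t : ℕ} (ht : t ≤ T) => hu.pulls_one_le hc hB hL ht
  set ν := scale α T / B.gap 1 ^ 2 with hνdef
  have hν : 0 < ν := by linarith
  have hsν : 0 < Real.sqrt ν := Real.sqrt_pos.mpr hν
  have hsum := pulls_add le_rfl (actions h)
  have hsum' : (pulls (actions h) T 0 : ℝ) + pulls (actions h) T 1 = T := by exact_mod_cast hsum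
  have hpT := hp1 le_rfl
  have hp0 : 57 * ν - 1 ≤ (pulls (actions h) T 0 : ℝ) := by linarith
  have hb : best (actions h) = 0 := by
    rcases arm_cases (best (actions h)) with hb | hb
    · exact hb
    · have h1 := hbest (actions h) 0
      rw [hb] at h1
      have h1' : (pulls (actions h) T 0 : ℝ) ≤ pulls (actions h) T 1 := by exact_mod_cast h1
      linarith
  have hp0' : 2 < pulls (actions h) T 0 := by
    have : (2 : ℝ) < pulls (actions h) T 0 := by linarith
    exact_mod_cast this
  -- the switching round
  have hne : (Finset.univ.filter (fun s : Fin T => actions h s = 1 ∧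
      ∃ s', s < s' ∧ actions h s' = best (actions h))).Nonempty := by
    have h2 := hu.pulls_two hT
    have h2' : pulls (actions h) 0 1 < pulls (actions h) 2 1 := by rw [pulls_zero]; omega
    obtain ⟨s, hs, -, hs2, hs1⟩ := exists_of_pulls_lt _ _ hT h2'
    have h3 := pulls_add hT (actions h)
    obtain ⟨s', hs', h4, -, h5⟩ := exists_of_pulls_lt (actions h) 0 (m := 2) le_rfl (by omega)
    refine ⟨⟨s, hs⟩, ?_⟩
    simp only [Finset.mem_filter, Finset.mem_univ, true_and]
    exact ⟨hs1, ⟨s', hs'⟩, by simp only [Fin.mk_lt_mk]; omega, by rw [hb]; exact h5⟩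
  obtain ⟨⟨s, hs⟩, hmem, hsup⟩ := Finset.exists_mem_eq_sup _ hne (fun s : Fin T => s.val + 1)
  have hmax : ∀ s' (hs' : s' < T), s < s' → actions h ⟨s', hs'⟩ = 1 →
      ∀ s'' (hs'' : s'' < T), s' < s'' → actions h ⟨s'', hs''⟩ ≠ 0 := by
    intro s' hs' hlt h1 s'' hs'' hlt' h0
    have := Finset.le_sup (f := fun s : Fin T => s.val + 1)
      (show (⟨s', hs'⟩ : Fin T) ∈ Finset.univ.filter (fun s : Fin T => actions h s = 1 ∧
      ∃ s', s < s' ∧ actions h s' = best (actions h)) by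
        simp only [Finset.mem_filter, Finset.mem_univ, true_and]
        exact ⟨h1, ⟨s'', hs''⟩, hlt', by rw [hb]; exact h0⟩)
    rw [hsup] at this
    simp only at this
    omega
  simp only [Finset.mem_filter, Finset.mem_univ, true_and] at hmem
  obtain ⟨hs1, ⟨s0, hs0⟩, hlt0, hs0b⟩ := hmem
  rw [hb] at hs0b
  have hlt0' : s < s0 := hlt0
  have hnext : s + 1 < T := by omega
  have hs2 : actions h ⟨s + 1, hnext⟩ = 0 := by
    rcases arm_cases (actions h ⟨s + 1, hnext⟩) with h1 | h1
    · exact h1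
    · have hne : s0 ≠ s + 1 := by
        rintro rfl
        rw [hs0b] at h1
        exact absurd h1 (by decide)
      exact absurd hs0b (hmax (s + 1) hnext (by omega) h1 s0 hs0 (by omega))
  have hest : ucbEstimate α best B.bestMean (actions h) 1 = B.mean 0 -
      (width α T (pulls (actions h) (s + 1) 1) - width α T (pulls (actions h) (s + 1) 0)) := by
    have e : ucbSwitch (best (actions h)) (actions h) 1 = s + 1 := hsup
    rw [ucbEstimate, e, hb, if_neg (by decide), Bandit.bestMean, max_eq_left hB.le]
  -- the number of pulls of the worse arm at the switching round
  set n1 := pulls (actions h) (s + 1) 0 with hn1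
  set n2 := pulls (actions h) (s + 1) 1 with hn2
  have hn2s : n2 = pulls (actions h) s 1 + 1 := by rw [hn2, pulls_succ hs, if_pos hs1]
  have hn1s : n1 = pulls (actions h) s 0 := by
    rw [hn1, pulls_succ hs, if_neg (by rw [hs1]; decide), add_zero]
  -- At the last pull u of the better arm the worse arm still has n2 pulls, since any pull between s
  -- and u would be a later switch. There the better arm has so many pulls that its width is at most
  -- Δ/5, so its winning forces C(n2)/4 ≤ Δ + 7/4 · Δ/5.
  have hw6 : width α T n2 ≤ 6 * B.gap 1 := by
    obtain ⟨u, hu', hu0, hulast, hupulls⟩ := exists_last_pull (actions h) 0 (by omega)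
    have hsu : s < u := by
      by_contra hle
      exact hulast s0 hs0 (by omega) hs0b
    have hu2 : pulls (actions h) u 1 = n2 := by
      refine pulls_eq_of_forall_ne _ _ hu'.le (by omega) fun s' hs' h1 h2 h3 => ?_
      exact hmax s' hs' (by omega) h3 u hu' h2 hu0
    have hu1 : pulls (actions h) u 0 + 1 = pulls (actions h) T 0 := by
      rw [← hupulls, pulls_succ hu', if_pos hu0]
    have hu1' : (pulls (actions h) u 0 : ℝ) + 1 = pulls (actions h) T 0 := by exact_mod_cast hu1
    rcases hu u hu' 0 hu0 with h1 | h1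
    · omega
    · have h2 := abs_le.mp (hc 0 u hu'.le (h1 0).1)
      have h3 := abs_le.mp (hc 1 u hu'.le (h1 1).1)
      have h4 := (h1 1).2
      have h5 : width α T (pulls (actions h) u 0) ≤ 1 / 5 * B.gap 1 :=
        width_le_mul hΔ (by norm_num) (by linarith)
      rw [hu2] at h3 h4
      linarith
  have hn2' : n2 ≠ 0 := by omega
  have hνn2 : 2 * ν ≤ 6 ^ 2 * n2 := le_of_mul_width_le hL hΔ hn2' hw6
  have hd0 := devMax_nonneg ν 0 (B.mean 0) h
  have hd1 := devMax_nonneg ν 1 (B.mean 1) h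
  rw [hest]
  -- With no earlier pull of the worse arm there is no index comparison at s. Then n2 = 1 forces ν ≤
  -- 18, and a constant error suffices.
  rcases Nat.eq_zero_or_pos (pulls (actions h) s 1) with hk0 | hk
  · have hn21 : n2 = 1 := by omega
    rw [hn21] at hw6 hνn2
    have h1 := width_le_width_one (α := α) (T := T) hL n1
    have h2 := width_nonneg α T n1
    have h3 := width_nonneg α T 1
    have h4 : |B.mean 0 - (width α T n2 - width α T n1) - B.mean 1| ≤ 7 := by
      rw [hn21, abs_le]
      constructor <;> linarith
    have h5 : 7 ≤ 4000 / Real.sqrt ν := by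
      rw [le_div_iff₀ hsν]
      have : Real.sqrt ν ≤ 5 := Real.sqrt_le_iff.mpr ⟨by norm_num, by push_cast at hνn2; linarith⟩
      linarith
    have h6 : 0 ≤ 4000 * (devMax ν 0 (B.mean 0) h + devMax ν 1 (B.mean 1) h) := by positivity
    linarith
  · set k := pulls (actions h) s 1 with hkdef
    have hk1 : (1 : ℝ) ≤ k := by exact_mod_cast hk
    have hn2r : (n2 : ℝ) = k + 1 := by rw [hn2s]; push_cast; rfl
    have hνk : ν ≤ 36 * k := by rw [hn2r] at hνn2; linarith
    have hA : ∀ j, pulls (actions h) s j ≠ 0 ∧ sampleMean h s j +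
        width α T (pulls (actions h) s j) ≤ sampleMean h s 1 + width α T k := by
      rcases hu s hs 1 hs1 with h1 | h1
      · omega
      · exact h1
    have hn10 : n1 ≠ 0 := by rw [hn1s]; exact (hA 0).1
    have hA0 := (hA 0).2
    rw [← hn1s] at hA0
    have hBd : sampleMean h (s + 1) 1 + width α T n2 ≤ sampleMean h (s + 1) 0 + width α T n1 := by
      rcases hu (s + 1) hnext 0 hs2 with h1 | h1
      · exact absurd h1 hn10
      · exact (h1 1).2
    -- The better arm lost at s, so its width is at most 7 C(k) ≤ 60Δ: it too has been pulled at
    -- least of order ν times.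
    have hνn1 : ν ≤ 1800 * n1 := by
      have h2 := abs_le.mp (hc 0 s hs.le (hA 0).1)
      have h3 := abs_le.mp (hc 1 s hs.le (hA 1).1)
      rw [← hn1s] at h2
      rw [← hkdef] at h3
      have h4 : width α T n1 ≤ 7 * width α T k := by linarith
      have h5 : width α T n1 ≤ 60 * B.gap 1 := by
        have : width α T k ≤ 17 / 2 * B.gap 1 :=
          width_le_mul hΔ (by norm_num) (by linarith)
        linarith
      have h6 := le_of_mul_width_le hL hΔ hn10 h5
      have : (0 : ℝ) ≤ n1 := Nat.cast_nonneg _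
      linarith
    have hD0 := abs_sampleMean_sub_le (K := 1800) hν 0 (B.mean 0) h hs.le (hA 0).1
      (by rw [← hn1s]; linarith)
    have hD1 := abs_sampleMean_sub_le (K := 1800) hν 1 (B.mean 1) h hs.le (hA 1).1
      (by rw [← hkdef]; linarith)
    have hE0 := abs_sampleMean_sub_le (K := 1800) hν 0 (B.mean 0) h hs hn10
      (by rw [← hn1]; linarith)
    have hE1 := abs_sampleMean_sub_le (K := 1800) hν 1 (B.mean 1) h hs hn2'
      (by rw [← hn2, hn2r]; linarith)
    have hwk : width α T k - width α T n2 ≤ 4000 / Real.sqrt ν := by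
      have h1 := width_sub_width_succ_le_of_le (K := 36) (c := 9) hL2 hΔ hΔ1 (by norm_num) hk.ne'
        (width_le_mul hΔ (by norm_num) (by linarith)) hνk
      rw [hn2s]
      refine h1.trans ?_
      rw [← hνdef]
      gcongr
      norm_num
    have hpos : 0 < 4000 / Real.sqrt ν := by positivity
    rw [abs_le] at hD0 hD1 hE0 hE1 ⊢
    constructor <;> linarith

end UCB

lemma ucb_estError_le {B : Bandit} (hB : B.mean 1 < B.mean 0) {π : Policy} {α : ℝ}
    (hα : 0 ≤ α) {T : ℕ} (hT : 2 ≤ T) (hTL : 64 * (scale α T / B.gap 1 ^ 2) ≤ T)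
    {best : (Fin T → Fin 2) → Fin 2} (hbest : IsMostPulled best) (hπ : IsUCB α T π) :
    estError B π T 1 (fun m a => ucbEstimate α best m a 1)
      ≤ (6 * 4000 + 1) * Real.sqrt (4000 + 8) * Real.sqrt (B.gap 1 / regret B π T) := by
  have hg := Bandit.gap_one hB
  have hΔ := gap_pos hB
  have hΔ1 := gap_le_one B
  have hL := half_le_scale hα hT
  have hν := half_le_scale_div hα hT hB
  refine estError_le_of_concentrated hB π hα hT hTL _ (by norm_num) (fun a => ?_) ?_
  · have hw := two_mul_width_le hα hT hΔ hΔ1 hTL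
    rw [ucbEstimate, Bandit.bestMean, max_eq_left hB.le]
    have hsT := Real.sqrt_nonneg (T : ℝ)
    split_ifs
    · rw [abs_le]; constructor <;> linarith
    · have h1 := hw (pulls a (ucbSwitch (best a) a 1) 1)
      have h2 := hw (pulls a (ucbSwitch (best a) a 1) (best a))
      have h3 := width_nonneg α T (pulls a (ucbSwitch (best a) a 1) 1)
      have h4 := width_nonneg α T (pulls a (ucbSwitch (best a) a 1) (best a))
      rw [abs_le]; constructor <;> linarith
  · filter_upwards [ae_followsUCB B hπ] with h hu hc
    refine ⟨hu.estimate hc hB hα hT hTL hbest, ?_, ?_⟩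
    · have h1 := hu.pulls_two hT
      have h2 := pulls_mono (actions h) 1 hT
      omega
    · have := hu.pulls_one_le hc hB (by linarith) le_rfl
      linarith

/-! ### Successive arm elimination -/

lemma one_lt_card_iff (s : Finset (Fin 2)) : 1 < s.card ↔ ∀ j, j ∈ s := by
  revert s; decide

/-- With two arms, the cardinality guard says that both are active; as an implication it suits both
the inductions and measurability. -/
lemma mem_saeActive_succ (α : ℝ) (T : ℕ) {t : ℕ} (h : Hist t) (e : ℕ) (i : Fin 2) :
    i ∈ saeActive α T h (e + 1) ↔ i ∈ saeActive α T h e ∧ ((∀ j, j ∈ saeActive α T h e) →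
      ¬ sampleMean h (2 * (e + 1)) i ≤
        max (sampleMean h (2 * (e + 1)) 0) (sampleMean h (2 * (e + 1)) 1)
          - 2 * width α T (e + 1)) := by
  rw [saeActive]
  split_ifs with hc
  · rw [Finset.mem_filter]
    have := (one_lt_card_iff _).mp hc
    exact and_congr_right fun _ => ⟨fun h _ => h, fun h => h this⟩
  · rw [one_lt_card_iff] at hc
    exact ⟨fun h => ⟨h, fun h' => absurd h' hc⟩, fun h => h.1⟩

lemma measurableSet_mem_saeActive (α : ℝ) (T t e : ℕ) (i : Fin 2) :
    MeasurableSet {h : Hist t | i ∈ saeActive α T h e} := by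
  induction e generalizing i with
  | zero => simp [saeActive]
  | succ e ih =>
    have h1 : MeasurableSet {h : Hist t | sampleMean h (2 * (e + 1)) i ≤
        max (sampleMean h (2 * (e + 1)) 0) (sampleMean h (2 * (e + 1)) 1)
          - 2 * width α T (e + 1)} :=
      measurableSet_le (measurable_sampleMean _ _)
        (((measurable_sampleMean _ _).max (measurable_sampleMean _ _)).sub_const _)
    have h2 : {h : Hist t | i ∈ saeActive α T h (e + 1)} = {h | i ∈ saeActive α T h e} ∩
        ((⋂ j, {h | j ∈ saeActive α T h e})ᶜ ∪ {h | sampleMean h (2 * (e + 1)) i ≤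
        max (sampleMean h (2 * (e + 1)) 0) (sampleMean h (2 * (e + 1)) 1)
          - 2 * width α T (e + 1)}ᶜ) := by
      ext h
      simp only [mem_saeActive_succ, Set.mem_ofPred_eq, Set.mem_inter_iff, Set.mem_union,
        Set.mem_compl_iff, Set.mem_iInter, imp_iff_not_or]
    rw [h2]
    exact (ih i).inter ((MeasurableSet.iInter fun j => ih j).compl.union h1.compl)

lemma measurableSet_saeAllowed (α : ℝ) (T t : ℕ) (i : Fin 2) :
    MeasurableSet {h : Hist t | i ∈ saeAllowed α T h} := by
  have e : {h : Hist t | i ∈ saeAllowed α T h} = {h | i ∈ saeActive α T h (t / 2)} ∩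
      ⋂ j, ({h | j ∈ saeActive α T h (t / 2)}ᶜ ∪
        {h | pulls (actions h) t i ≤ pulls (actions h) t j}) := by
    ext h
    simp [saeAllowed, imp_iff_not_or]
  rw [e]
  exact (measurableSet_mem_saeActive _ _ _ _ _).inter (MeasurableSet.iInter fun j =>
    (measurableSet_mem_saeActive _ _ _ _ _).compl.union
      (measurableSet_le (measurable_pulls t i) (measurable_pulls t j)))

lemma saeActive_restr (α : ℝ) (T : ℕ) {t n e : ℕ} (hn : n ≤ t) (he : 2 * e ≤ n) (h : Hist t) :
    saeActive α T (restr hn h) e = saeActive α T h e := by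
  induction e with
  | zero => rfl
  | succ e ih =>
    ext i
    rw [mem_saeActive_succ, mem_saeActive_succ, ih (by omega), sampleMean_restr hn he,
      sampleMean_restr hn he, sampleMean_restr hn he]

/-- Every round of the history follows the elimination rule. -/
def FollowsSAE (α : ℝ) {T : ℕ} (h : Hist T) : Prop :=
  ∀ t (ht : t < T) i, actions h ⟨t, ht⟩ = i → i ∈ saeActive α T h (t / 2) ∧
    ∀ j ∈ saeActive α T h (t / 2), pulls (actions h) t i ≤ pulls (actions h) t j

lemma ae_followsSAE (B : Bandit) {π : Policy} {α : ℝ} {T : ℕ} (hπ : IsSAE α T π) :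
    ∀ᵐ h ∂(law B π T), FollowsSAE α h := by
  filter_upwards [ae_allowed B π T (fun t h => saeAllowed α T h)
    (fun t i => measurableSet_saeAllowed α T t i) hπ] with h hh
  rintro t ht i rfl
  have := hh t ht
  simp only [saeAllowed, Set.mem_ofPred_eq, pulls_restr ht.le le_rfl,
    saeActive_restr α T ht.le (show 2 * (t / 2) ≤ t by omega)] at this
  exact this

lemma saeActive_anti (α : ℝ) (T : ℕ) {t : ℕ} (h : Hist t) {d e : ℕ} (hde : d ≤ e) {i : Fin 2}
    (hi : i ∈ saeActive α T h e) : i ∈ saeActive α T h d := by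
  induction e with
  | zero => obtain rfl : d = 0 := by omega
            exact hi
  | succ e ih =>
    rcases Nat.lt_or_ge e d with h1 | h1
    · obtain rfl : d = e + 1 := by omega
      exact hi
    · exact ih h1 ((mem_saeActive_succ α T h e i).mp hi).1

lemma pulls_saeSwitch {T : ℕ} (a : Fin T → Fin 2) (i : Fin 2) (hp : pulls a T i ≠ 0) :
    pulls a (saeSwitch a i) i = pulls a T i := by
  obtain ⟨s, hs, h1, h2, h3⟩ := exists_last_pull a i hp
  have e : saeSwitch a i = s + 1 := by
    refine le_antisymm (Finset.sup_le fun u hu => ?_) ?_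
    · simp only [Finset.mem_filter, Finset.mem_univ, true_and] at hu
      by_contra hlt
      exact h2 u.1 u.2 (by omega) hu.1
    · refine Finset.le_sup (f := fun s : Fin T => s.val + 1) (b := ⟨s, hs⟩) ?_
      simp only [Finset.mem_filter, Finset.mem_univ, true_and]
      exact ⟨h1, fun s' hs' => h2 s'.1 s'.2 hs'⟩
  rw [e, h3]

section SAE

variable {B : Bandit} {α : ℝ} {T : ℕ} {h : Hist T}

/-- While both arms are active, each epoch pulls each of them once. -/
lemma FollowsSAE.pulls_epoch (hs : FollowsSAE α h) {e : ℕ} (he : 2 * e ≤ T)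
    (hact : ∀ d < e, ∀ j, j ∈ saeActive α T h d) (i : Fin 2) :
    pulls (actions h) (2 * e) i = e := by
  induction e generalizing i with
  | zero => exact pulls_zero _ _
  | succ e ih =>
    have ih := ih (by omega) fun d hd => hact d (by omega)
    have e2 : 2 * (e + 1) = 2 * e + 1 + 1 := by ring
    have h1 : 2 * e < T := by omega
    have h2 : 2 * e + 1 < T := by omega
    have hne : actions h ⟨2 * e + 1, h2⟩ ≠ actions h ⟨2 * e, h1⟩ := by
      intro heq
      have h3 := (hs (2 * e + 1) h2 _ rfl).2
      rw [show (2 * e + 1) / 2 = e by omega, heq] at h3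
      have hj : ∃ j, j ≠ actions h ⟨2 * e, h1⟩ := exists_ne _
      obtain ⟨j, hj⟩ := hj
      have h4 := h3 j (hact e (by omega) j)
      rw [pulls_succ h1, pulls_succ h1, if_pos rfl, if_neg hj.symm, ih, ih] at h4
      omega
    rw [e2, pulls_succ h2, pulls_succ h1, ih]
    have h3 : ∀ x y z : Fin 2, y ≠ x → (if x = z then 1 else 0) + (if y = z then 1 else 0) = 1 := by
      decide
    have := h3 _ _ i hne
    omega

/-- Elimination of the better arm would need a deficit of 2C, but concentration allows at most 3/2 ·
C - Δ. -/
lemma FollowsSAE.zero_mem_active (hs : FollowsSAE α h) (hc : Concentrated B α h)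
    (hB : B.mean 1 < B.mean 0) (hL : 0 < scale α T) {e : ℕ} (he : 2 * e ≤ T) :
    0 ∈ saeActive α T h e := by
  induction e with
  | zero => simp [saeActive]
  | succ e ih =>
    rw [mem_saeActive_succ]
    refine ⟨ih (by omega), fun hall => ?_⟩
    have hp := fun i => hs.pulls_epoch he
      (fun d hd j => saeActive_anti α T h (show d ≤ e by omega) (hall j)) i
    have h0 := hc 0 _ he (by rw [hp]; omega)
    have h1 := hc 1 _ he (by rw [hp]; omega)
    rw [hp, abs_le] at h0 h1
    have hw := width_pos hL (Nat.succ_ne_zero e)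
    rw [not_le, sub_lt_iff_lt_add]
    apply max_lt <;> linarith

/-- On the concentration event the worse arm is eliminated, at the end of the epoch counted by its
pulls. -/
lemma FollowsSAE.exists_drop (hs : FollowsSAE α h) (hc : Concentrated B α h)
    (hB : B.mean 1 < B.mean 0) (hα : 0 ≤ α) (hT : 2 ≤ T)
    (hTL : 64 * (scale α T / B.gap 1 ^ 2) ≤ T) :
    ∃ k, 2 * (k + 1) ≤ T ∧ pulls (actions h) T 1 = k + 1 ∧
      (k : ℝ) ≤ 49 / 2 * (scale α T / B.gap 1 ^ 2) ∧
      (∀ d ≤ k + 1, ∀ i, pulls (actions h) (2 * d) i = d) ∧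
      sampleMean h (2 * (k + 1)) 1 ≤ sampleMean h (2 * (k + 1)) 0 - 2 * width α T (k + 1) ∧
      (k ≠ 0 → sampleMean h (2 * k) 0 - 2 * width α T k < sampleMean h (2 * k) 1) := by
  have hL : 0 < scale α T := by linarith [half_le_scale hα hT]
  have hΔ := gap_pos hB
  have hg := Bandit.gap_one hB
  have hν1 := half_le_scale_div hα hT hB
  set ν := scale α T / B.gap 1 ^ 2 with hνdef
  -- If the worse arm survived epoch n, then Δ < (2 + 3/4 + 3/4) C(n), that is n ≤ 49/2 · ν. Epoch
  -- e0 + 1 violates this and ends before T because T ≥ 64ν.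
  set e0 := ⌊49 / 2 * ν⌋₊ with he0
  have hle : (e0 : ℝ) ≤ 49 / 2 * ν := Nat.floor_le (by linarith)
  have hlt : 49 / 2 * ν < e0 + 1 := Nat.lt_floor_add_one _
  have he0T : 2 * (e0 + 1) ≤ T := by
    have : (2 * (e0 + 1) : ℝ) ≤ T := by linarith
    exact_mod_cast this
  have hdrop : 1 ∉ saeActive α T h (e0 + 1) := by
    intro h1
    have hall : ∀ d < e0 + 1, ∀ j, j ∈ saeActive α T h d := fun d hd j => by
      rcases arm_cases j with rfl | rfl
      · exact hs.zero_mem_active hc hB hL (by omega)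
      · exact saeActive_anti α T h hd.le h1
    have hp := hs.pulls_epoch he0T hall
    have h2 := ((mem_saeActive_succ α T h e0 1).mp h1).2 (hall e0 (Nat.lt_succ_self _))
    have h3 := hc 0 _ he0T (by rw [hp]; omega)
    have h4 := hc 1 _ he0T (by rw [hp]; omega)
    rw [hp, abs_le] at h3 h4
    have h5 : sampleMean h (2 * (e0 + 1)) 0 - 2 * width α T (e0 + 1)
        < sampleMean h (2 * (e0 + 1)) 1 := by
      refine lt_of_le_of_lt ?_ (not_le.mp h2)
      linarith [le_max_left (sampleMean h (2 * (e0 + 1)) 0) (sampleMean h (2 * (e0 + 1)) 1)]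
    have h6 : B.gap 1 ≤ 7 / 2 * width α T (e0 + 1) := by linarith
    have h7 := le_of_le_mul_width hL.le hΔ (Nat.succ_ne_zero e0) h6
    push_cast at h7
    linarith
  have hex : ∃ e, 1 ∉ saeActive α T h e := ⟨_, hdrop⟩
  classical
  have hfind := Nat.find_spec hex
  have hmin : ∀ d < Nat.find hex, 1 ∈ saeActive α T h d := fun d hd =>
    not_not.mp (Nat.find_min hex hd)
  have hfe : Nat.find hex ≤ e0 + 1 := Nat.find_min' hex hdrop
  obtain ⟨k, hk⟩ : ∃ k, Nat.find hex = k + 1 := by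
    refine Nat.exists_eq_succ_of_ne_zero fun h0 => ?_
    rw [h0] at hfind
    simp [saeActive] at hfind
  rw [hk] at hfind hmin hfe
  have hkT : 2 * (k + 1) ≤ T := by omega
  have hall : ∀ d < k + 1, ∀ j, j ∈ saeActive α T h d := fun d hd j => by
    rcases arm_cases j with rfl | rfl
    · exact hs.zero_mem_active hc hB hL (by omega)
    · exact hmin d hd
  have hp : ∀ d ≤ k + 1, ∀ i, pulls (actions h) (2 * d) i = d := fun d hd i =>
    hs.pulls_epoch (by omega) (fun d' hd' => hall d' (by omega)) i
  refine ⟨k, hkT, ?_, ?_, hp, ?_, fun hk0 => ?_⟩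
  · rw [← hp (k + 1) le_rfl 1]
    refine pulls_eq_of_forall_ne _ _ le_rfl hkT fun s hsT hle _ h1 => ?_
    exact hfind (saeActive_anti α T h (by omega) (hs s hsT 1 h1).1)
  · have : (k : ℝ) ≤ e0 := by exact_mod_cast (by omega : k ≤ e0)
    linarith
  · rw [mem_saeActive_succ] at hfind
    have h1 : sampleMean h (2 * (k + 1)) 1 ≤ max (sampleMean h (2 * (k + 1)) 0)
        (sampleMean h (2 * (k + 1)) 1) - 2 * width α T (k + 1) := by
      by_contra hcon
      exact hfind ⟨hmin k (by omega), fun _ => hcon⟩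
    have hw := width_pos hL (Nat.succ_ne_zero k)
    rcases le_total (sampleMean h (2 * (k + 1)) 0) (sampleMean h (2 * (k + 1)) 1) with h2 | h2
    · rw [max_eq_right h2] at h1; linarith
    · rwa [max_eq_left h2] at h1
  · obtain ⟨k', rfl⟩ := Nat.exists_eq_succ_of_ne_zero hk0
    have h1 := ((mem_saeActive_succ α T h k' 1).mp (hmin (k' + 1) (by omega))).2
      (hall k' (by omega))
    refine lt_of_le_of_lt ?_ (not_le.mp h1)
    linarith [le_max_left (sampleMean h (2 * (k' + 1)) 0) (sampleMean h (2 * (k' + 1)) 1)]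

/-- The worse arm is kept at the end of epoch k and dropped at the end of epoch k + 1, which
brackets 2C(k+1) around Δ. Dropping also forces C(k+1) ≤ 2Δ, so the arm has been pulled at least ν/2
times. -/
lemma FollowsSAE.estimate (hs : FollowsSAE α h) (hc : Concentrated B α h)
    (hB : B.mean 1 < B.mean 0) (hα : 0 ≤ α) (hT : 2 ≤ T)
    (hTL : 64 * (scale α T / B.gap 1 ^ 2) ≤ T)
    {best : (Fin T → Fin 2) → Fin 2} (hbest : IsMostPulled best) :
    |saeEstimate α best B.bestMean (actions h) 1 - B.mean 1| ≤
      50 * (devMax (scale α T / B.gap 1 ^ 2) 0 (B.mean 0) h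
        + devMax (scale α T / B.gap 1 ^ 2) 1 (B.mean 1) h)
      + 50 / Real.sqrt (scale α T / B.gap 1 ^ 2) ∧
    1 ≤ pulls (actions h) T 1 ∧
    (pulls (actions h) T 1 : ℝ) ≤ 50 * (scale α T / B.gap 1 ^ 2) := by
  have hL2 := half_le_scale hα hT
  have hL : 0 ≤ scale α T := by linarith
  have hΔ := gap_pos hB
  have hΔ1 := gap_le_one B
  have hg := Bandit.gap_one hB
  have hν1 := half_le_scale_div hα hT hB
  obtain ⟨k, hkT, hpk, hkν, hp, hdrop, hkeep⟩ := hs.exists_drop hc hB hα hT hTL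
  set ν := scale α T / B.gap 1 ^ 2 with hνdef
  have hν : 0 < ν := by linarith
  have hsν : 0 < Real.sqrt ν := Real.sqrt_pos.mpr hν
  have hd0 := devMax_nonneg ν 0 (B.mean 0) h
  have hd1 := devMax_nonneg ν 1 (B.mean 1) h
  refine ⟨?_, by omega, by rw [hpk]; push_cast; linarith⟩
  have hb : best (actions h) = 0 := by
    rcases arm_cases (best (actions h)) with hb | hb
    · exact hb
    · have h1 := hbest (actions h) 0
      have h2 := pulls_add le_rfl (actions h)
      rw [hb] at h1
      have h3 : (T : ℝ) ≤ 2 * (k + 1) := by exact_mod_cast (by omega : T ≤ 2 * (k + 1))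
      linarith
  have hest : saeEstimate α best B.bestMean (actions h) 1
      = B.mean 0 - 2 * width α T (k + 1) := by
    rw [saeEstimate, hb, if_neg (by decide), Bandit.bestMean, max_eq_left hB.le,
      pulls_saeSwitch _ _ (by omega), hpk]
  rw [hest]
  have hpe := hp (k + 1) le_rfl
  have hw2 : width α T (k + 1) ≤ 2 * B.gap 1 := by
    have h0 := hc 0 _ hkT (by rw [hpe]; omega)
    have h1 := hc 1 _ hkT (by rw [hpe]; omega)
    rw [hpe, abs_le] at h0 h1
    linarith
  have hνe := le_of_mul_width_le hL hΔ (Nat.succ_ne_zero k) hw2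
  rw [← hνdef] at hνe
  have hw0 := width_nonneg α T (k + 1)
  -- A drop after the first epoch has no preceding comparison, but then ν ≤ 2 and a constant error
  -- is enough.
  rcases Nat.eq_zero_or_pos k with rfl | hk
  · have h4 : |B.mean 0 - 2 * width α T (0 + 1) - B.mean 1| ≤ 4 := by
      rw [abs_le]; constructor <;> linarith
    have h5 : 4 ≤ 50 / Real.sqrt ν := by
      rw [le_div_iff₀ hsν]
      have : Real.sqrt ν ≤ 2 := Real.sqrt_le_iff.mpr ⟨by norm_num, by push_cast at hνe; linarith⟩
      linarith
    have h6 : 0 ≤ 50 * (devMax ν 0 (B.mean 0) h + devMax ν 1 (B.mean 1) h) := by positivity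
    linarith
  · have hk1 : (1 : ℝ) ≤ k := by exact_mod_cast hk
    push_cast at hνe
    have hνk : ν ≤ 4 * k := by linarith
    have hpk' := hp k (Nat.le_succ k)
    have hD := fun i => abs_sampleMean_sub_le (K := 4) hν i (B.mean i) h hkT
      (by rw [hpe]; omega) (by rw [hpe]; push_cast; linarith)
    have hE := fun i => abs_sampleMean_sub_le (K := 4) hν i (B.mean i) h
      (show 2 * k ≤ T by omega) (by rw [hpk']; omega) (by rw [hpk']; linarith)
    have hD0 := abs_le.mp (hD 0)
    have hD1 := abs_le.mp (hD 1)
    have hE0 := abs_le.mp (hE 0)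
    have hE1 := abs_le.mp (hE 1)
    have hkeep := hkeep hk.ne'
    have hwk : width α T k - width α T (k + 1) ≤ 24 / Real.sqrt ν := by
      have h1 := width_sub_width_succ_le_of_le (K := 4) (c := 3) hL2 hΔ hΔ1 (by norm_num) hk.ne'
        (width_le_mul hΔ (by norm_num) (by linarith)) hνk
      refine h1.trans ?_
      rw [← hνdef]
      gcongr
      norm_num
    have hpos : 0 < 1 / Real.sqrt ν := by positivity
    have e1 : 24 / Real.sqrt ν = 24 * (1 / Real.sqrt ν) := by ring
    have e2 : 50 / Real.sqrt ν = 50 * (1 / Real.sqrt ν) := by ring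
    rw [e1] at hwk
    rw [e2, abs_le]
    constructor <;> linarith

end SAE

lemma sae_estError_le {B : Bandit} (hB : B.mean 1 < B.mean 0) {π : Policy} {α : ℝ}
    (hα : 0 ≤ α) {T : ℕ} (hT : 2 ≤ T) (hTL : 64 * (scale α T / B.gap 1 ^ 2) ≤ T)
    {best : (Fin T → Fin 2) → Fin 2} (hbest : IsMostPulled best) (hπ : IsSAE α T π) :
    estError B π T 1 (fun m a => saeEstimate α best m a 1)
      ≤ (6 * 50 + 1) * Real.sqrt (50 + 8) * Real.sqrt (B.gap 1 / regret B π T) := by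
  have hg := Bandit.gap_one hB
  have hΔ := gap_pos hB
  have hΔ1 := gap_le_one B
  refine estError_le_of_concentrated hB π hα hT hTL _ (by norm_num) (fun a => ?_) ?_
  · have hw := two_mul_width_le hα hT hΔ hΔ1 hTL
    rw [saeEstimate, Bandit.bestMean, max_eq_left hB.le]
    have hsT := Real.sqrt_nonneg (T : ℝ)
    split_ifs
    · rw [abs_le]; constructor <;> linarith
    · have h1 := hw (pulls a (saeSwitch a 1) 1)
      have h3 := width_nonneg α T (pulls a (saeSwitch a 1) 1)
      rw [abs_le]; constructor <;> linarith
  · filter_upwards [ae_followsSAE B hπ] with h hs hc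
    exact hs.estimate hc hB hα hT hTL hbest

/-! ### Change of measure between two instances -/

lemma measurable_lintegral_addRound (B : Bandit) (π : Policy) (t : ℕ)
    {F : Hist (t + 1) → ENNReal} (hF : Measurable F) :
    Measurable fun h : Hist t =>
      ∫⁻ i, ∫⁻ r, F (addRound h (i, r)) ∂(B.reward i) ∂(π.next t h) := by
  have h1 := (hF.comp measurable_addRound).lintegral_kernel_prod_right' (κ := stepKernel B π t)
  convert h1 using 2 with h
  change _ = ∫⁻ x, F (addRound h x) ∂(stepKernel B π t h)
  rw [stepKernel, Kernel.lintegral_compProd (f := fun x : Fin 2 × ℝ => F (addRound h x)) _ _ _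
    ((hF.comp measurable_addRound).comp measurable_prodMk_left)]
  rfl

/-- The likelihood ratio of a history is the product of the likelihood ratios of its rewards. -/
lemma lintegral_law_change {B B' : Bandit} (π : Policy) {ρ : Fin 2 × ℝ → ENNReal}
    (hρ : Measurable ρ)
    (hB : ∀ i, ∀ f : ℝ → ENNReal, Measurable f →
      ∫⁻ r, f r ∂(B'.reward i) = ∫⁻ r, ρ (i, r) * f r ∂(B.reward i)) (t : ℕ)
    {F : Hist t → ENNReal} (hF : Measurable F) :
    ∫⁻ h, F h ∂(law B' π t) = ∫⁻ h, (∏ s, ρ (h s)) * F h ∂(law B π t) := by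
  induction t with
  | zero => simp [law]
  | succ t ih =>
    have hprod : Measurable fun h : Hist (t + 1) => (∏ s, ρ (h s)) * F h :=
      (Finset.measurable_prod _ fun s _ => hρ.comp (measurable_pi_apply s)).mul hF
    rw [lintegral_law_succ B' π t hF, lintegral_law_succ B π t hprod,
      ih (measurable_lintegral_addRound B' π t hF)]
    refine lintegral_congr fun h => ?_
    rw [← lintegral_const_mul _ (measurable_of_countable _)]
    refine lintegral_congr fun i => ?_
    have hm : Measurable fun r => F (addRound h (i, r)) := hF.comp (measurable_addRound_arm h i)
    rw [hB i _ hm, ← lintegral_const_mul]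
    · refine lintegral_congr fun r => ?_
      rw [Fin.prod_univ_castSucc]
      simp only [addRound_castSucc, addRound_last]
      ring
    · exact (hρ.comp measurable_prodMk_left).mul hm

/-- The ratio is assumed nonnegative only for rewards in the unit interval, so real and extended
products agree almost surely rather than everywhere. -/
lemma integral_law_change {B B' : Bandit} (π : Policy) {ρ : Fin 2 × ℝ → ℝ} (hρ : Measurable ρ)
    (hρ0 : ∀ i, ∀ r ∈ Set.Icc (0 : ℝ) 1, 0 ≤ ρ (i, r))
    (hB : ∀ i, ∀ f : ℝ → ENNReal, Measurable f →
      ∫⁻ r, f r ∂(B'.reward i) = ∫⁻ r, ENNReal.ofReal (ρ (i, r)) * f r ∂(B.reward i)) (t : ℕ)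
    {F : Hist t → ℝ} (hF : Measurable F) (hF0 : ∀ h, 0 ≤ F h) :
    ∫ h, F h ∂(law B' π t) = ∫ h, (∏ s, ρ (h s)) * F h ∂(law B π t) := by
  have hprod : Measurable fun h : Hist t => (∏ s, ρ (h s)) * F h :=
    (Finset.measurable_prod _ fun s _ => hρ.comp (measurable_pi_apply s)).mul hF
  have hpos : ∀ h : Hist t, UnitRewards h → ∀ s, 0 ≤ ρ (h s) := fun h hh s =>
    hρ0 (h s).1 (h s).2 (hh s)
  rw [integral_eq_lintegral_of_nonneg_ae (Filter.Eventually.of_forall hF0)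
    hF.aestronglyMeasurable, integral_eq_lintegral_of_nonneg_ae _ hprod.aestronglyMeasurable,
    lintegral_law_change π hρ.ennreal_ofReal hB t hF.ennreal_ofReal]
  · congr 1
    refine lintegral_congr_ae ?_
    filter_upwards [ae_unitRewards B π t] with h hh
    rw [ENNReal.ofReal_mul (Finset.prod_nonneg fun s _ => hpos h hh s),
      ENNReal.ofReal_prod_of_nonneg fun s _ => hpos h hh s]
  · filter_upwards [ae_unitRewards B π t] with h hh
    exact mul_nonneg (Finset.prod_nonneg fun s _ => hpos h hh s) (hF0 h)

/-! ### Two Bernoulli instances -/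

lemma lintegral_bernoulli (p : unitInterval) (f : ℝ → ENNReal) :
    ∫⁻ r, f r ∂(bernoulliMeasure (1 : ℝ) 0 p)
      = ENNReal.ofReal p * f 1 + ENNReal.ofReal (1 - p) * f 0 := by
  rw [bernoulliMeasure_def, lintegral_add_measure, lintegral_smul_measure, lintegral_smul_measure,
    lintegral_dirac, lintegral_dirac]
  simp only [ENNReal.smul_def, smul_eq_mul, ENNReal.coe_nnreal_eq, unitInterval.coe_toNNReal,
    unitInterval.coe_symm_eq]

lemma integral_id_bernoulli (p : unitInterval) :
    ∫ r, r ∂(bernoulliMeasure (1 : ℝ) 0 p) = p := by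
  rw [integral_bernoulliMeasure]; simp

/-- The instance in which the second arm's rewards are replaced by Bernoulli rewards. -/
noncomputable def Bandit.withSecond (B : Bandit) (q : unitInterval) : Bandit where
  reward i := if i = 0 then B.reward 0 else bernoulliMeasure (1 : ℝ) 0 q
  prob i := by split_ifs <;> infer_instance
  supp i := by
    split_ifs
    · exact B.supp 0
    · rw [bernoulliMeasure_def, ae_add_measure_iff]
      constructor <;> refine Measure.ae_smul_measure ?_ _ <;>
        · rw [ae_dirac_eq]; simp

/-- With y = x - 2x², e^y ≤ 1 + y + y², and y² = x²(1 - 2x)² ≤ 2x² absorbs the correction. -/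
lemma exp_sub_two_mul_sq_le {x : ℝ} (hx : |x| ≤ 1 / 6) : Real.exp (x - 2 * x ^ 2) ≤ 1 + x := by
  have hx' := abs_le.mp hx
  have hx2 : x ^ 2 ≤ 1 / 36 := by nlinarith
  have h1 : |x - 2 * x ^ 2| ≤ 1 := by rw [abs_le]; constructor <;> nlinarith
  have h2 := (abs_le.mp (Real.abs_exp_sub_one_sub_id_le h1)).2
  have h3 : (1 - 2 * x) ^ 2 ≤ 2 := by nlinarith
  have h4 := mul_le_mul_of_nonneg_left h3 (sq_nonneg x)
  nlinarith

/-- The likelihood ratio of the arm-reward pair when the second Bernoulli mean moves from `p`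
to `p - k p (1 - p)`. -/
noncomputable def ratio (k p : ℝ) (x : Fin 2 × ℝ) : ℝ := if x.1 = 1 then 1 - k * (x.2 - p) else 1

lemma le_prod_ratio {k p : ℝ} (hk : |k| ≤ 1 / 6) (hp : p ∈ Set.Icc (0 : ℝ) 1) {T : ℕ} {h : Hist T}
    (hh : UnitRewards h) :
    3 / 4 - k ^ 2 * transform (fun _ => 1) 1 p h T ^ 2 - 2 * k ^ 2 * pulls (actions h) T 1
      ≤ ∏ s, ratio k p (h s) := by
  have hle : ∀ s, |(h s).2 - p| ≤ 1 := fun s => by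
    rw [abs_le]; constructor <;> linarith [(hh s).1, (hh s).2, hp.1, hp.2]
  set x : Fin T → ℝ := fun s => if (h s).1 = 1 then -(k * ((h s).2 - p)) else 0 with hx
  have hxle : ∀ s, |x s| ≤ 1 / 6 := fun s => by
    simp only [hx]
    split_ifs
    · rw [abs_neg, abs_mul]
      nlinarith [hle s, abs_nonneg k, abs_nonneg ((h s).2 - p)]
    · norm_num
  have hsum : ∑ s, x s = -k * transform (fun _ => 1) 1 p h T := by
    rw [transform, Finset.mul_sum]
    refine Finset.sum_congr rfl fun s _ => ?_
    simp only [hx, s.2, if_true]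
    split_ifs <;> ring
  have hsq : ∑ s, x s ^ 2 ≤ k ^ 2 * pulls (actions h) T 1 := by
    rw [cast_pulls, Finset.mul_sum]
    refine Finset.sum_le_sum fun s _ => ?_
    simp only [hx, s.2, if_true, actions]
    by_cases hs : (h s).1 = 1
    · simp only [hs, if_true]
      rw [neg_sq, mul_pow]
      have := (sq_le_one_iff_abs_le_one _).mpr (hle s)
      nlinarith [sq_nonneg k]
    · simp [hs]
  have hprod : Real.exp (∑ s, (x s - 2 * x s ^ 2)) ≤ ∏ s, ratio k p (h s) := by
    rw [Real.exp_sum]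
    refine Finset.prod_le_prod (fun s _ => (Real.exp_pos _).le) fun s _ => ?_
    refine (exp_sub_two_mul_sq_le (hxle s)).trans (le_of_eq ?_)
    simp only [hx, ratio]
    split_ifs <;> ring
  refine le_trans ?_ hprod
  refine le_trans ?_ (Real.add_one_le_exp _)
  rw [Finset.sum_sub_distrib, ← Finset.mul_sum, hsum]
  -- Completing the square: 1 - kS ≥ 3/4 - k²S².
  nlinarith [sq_nonneg (-k * transform (fun _ => 1) 1 p h T + 1 / 2)]

lemma ratio_nonneg {k p : ℝ} (hk : |k| ≤ 1 / 6) (hp : p ∈ Set.Icc (0 : ℝ) 1) (i : Fin 2) {r : ℝ}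
    (hr : r ∈ Set.Icc (0 : ℝ) 1) : 0 ≤ ratio k p (i, r) := by
  unfold ratio
  split_ifs
  · have h1 : |r - p| ≤ 1 := by
      rw [abs_le]; constructor <;> linarith [hr.1, hr.2, hp.1, hp.2]
    have h2 : |k * (r - p)| ≤ 1 := by
      rw [abs_mul]; nlinarith [abs_nonneg k, abs_nonneg (r - p)]
    change 0 ≤ 1 - k * (r - p)
    linarith [(abs_le.mp h2).2]
  · exact zero_le_one

lemma measurable_ratio (k p : ℝ) : Measurable (ratio k p) := by
  unfold ratio
  exact Measurable.ite (measurableSet_eq_fun (by fun_prop) measurable_const) (by fun_prop)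
    measurable_const

/-- The two atoms match: p(1 - k(1 - p)) = q and (1 - p)(1 + kp) = 1 - q. -/
lemma lintegral_withSecond {B : Bandit} {p q : unitInterval}
    (hp : B.reward 1 = bernoulliMeasure (1 : ℝ) 0 p) {k : ℝ}
    (hq : (q : ℝ) = p - k * (p * (1 - p))) (i : Fin 2) (f : ℝ → ENNReal) :
    ∫⁻ r, f r ∂((B.withSecond q).reward i)
      = ∫⁻ r, ENNReal.ofReal (ratio k p (i, r)) * f r ∂(B.reward i) := by
  rcases arm_cases i with rfl | rfl
  · simp [Bandit.withSecond, ratio]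
  · have e : (B.withSecond q).reward 1 = bernoulliMeasure (1 : ℝ) 0 q := by
      simp [Bandit.withSecond]
    rw [e, hp, lintegral_bernoulli, lintegral_bernoulli, ← mul_assoc, ← mul_assoc,
      ← ENNReal.ofReal_mul p.2.1, ← ENNReal.ofReal_mul (by linarith [p.2.2])]
    congr 3
    · rw [hq]; simp only [ratio, if_true]; ring
    · rw [hq]; simp only [ratio, if_true]; ring

/-- Two-point lower bound for estimators that observe only the actions. -/
lemma le_estError_add_estError {B : Bandit} {p q : unitInterval}
    (hp : B.reward 1 = bernoulliMeasure (1 : ℝ) 0 p) {k : ℝ} (hk : |k| ≤ 1 / 6)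
    (hq : (q : ℝ) = p - k * (p * (1 - p))) (π : Policy) (T : ℕ)
    (hbest : (B.withSecond q).bestMean = B.bestMean) (est : ℝ → (Fin T → Fin 2) → ℝ) :
    |(p : ℝ) - q| * (3 / 4 - 6 * k ^ 2 * ∫ h, (pulls (actions h) T 1 : ℝ) ∂(law B π T))
      ≤ estError B π T 1 est + estError (B.withSecond q) π T 1 est := by
  have hmp : B.mean 1 = p := by rw [Bandit.mean, hp, integral_id_bernoulli]
  have hmq : (B.withSecond q).mean 1 = q := by
    have e : (B.withSecond q).reward 1 = bernoulliMeasure (1 : ℝ) 0 q := by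
      simp [Bandit.withSecond]
    rw [Bandit.mean, e, integral_id_bernoulli]
  have hp01 : (p : ℝ) ∈ Set.Icc (0 : ℝ) 1 := p.2
  set g : (Fin T → Fin 2) → ℝ := est B.bestMean
  have hbound : ∀ (c : ℝ) (h : Hist T), |g (actions h) - c| ≤ ∑ a, |g a - c| := fun c h =>
    Finset.single_le_sum (f := fun a => |g a - c|) (fun a _ => abs_nonneg _) (Finset.mem_univ _)
  have hmeas : ∀ c : ℝ, Measurable fun h : Hist T => |g (actions h) - c| := fun c =>
    measurable_of_actions (fun a => |g a - c|)
  have h2 : estError (B.withSecond q) π T 1 est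
      = ∫ h, (∏ s, ratio k p (h s)) * |g (actions h) - q| ∂(law B π T) := by
    rw [estError, hbest, hmq]
    exact integral_law_change π (measurable_ratio k p)
      (fun i r hr => ratio_nonneg hk hp01 i hr)
      (fun i f _ => lintegral_withSecond hp hq i f) T (hmeas q) fun h => abs_nonneg _
  have hratio2 : ∀ i, ∀ r ∈ Set.Icc (0 : ℝ) 1, ratio k p (i, r) ≤ 2 := fun i r hr => by
    unfold ratio
    split_ifs
    · have h1 : |r - p| ≤ 1 := by
        rw [abs_le]; constructor <;> linarith [hr.1, hr.2, hp01.1, hp01.2]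
      have h2 : |k * (r - p)| ≤ 1 := by
        rw [abs_mul]; nlinarith [abs_nonneg k, abs_nonneg (r - p)]
      change 1 - k * (r - p) ≤ 2
      linarith [(abs_le.mp h2).1]
    · norm_num
  have hI1 : Integrable (fun h => |g (actions h) - p|) (law B π T) :=
    integrable_of_unitRewards (hmeas p) fun h _ => by rw [abs_abs]; exact hbound p h
  have hI2 : Integrable (fun h => (∏ s, ratio k p (h s)) * |g (actions h) - q|) (law B π T) := by
    refine integrable_of_unitRewards (K := 2 ^ T * ∑ a, |g a - q|)
      ((Finset.measurable_prod _ fun s _ =>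
        (measurable_ratio k p).comp (measurable_pi_apply s)).mul (hmeas q)) fun h hh => ?_
    have hpos : 0 ≤ ∏ s, ratio k p (h s) :=
      Finset.prod_nonneg fun s _ => ratio_nonneg hk hp01 (h s).1 (hh s)
    rw [abs_mul, abs_abs, abs_of_nonneg hpos]
    refine mul_le_mul ?_ (hbound q h) (abs_nonneg _) (by positivity)
    calc ∏ s, ratio k p (h s) ≤ ∏ _s : Fin T, (2 : ℝ) :=
          Finset.prod_le_prod (fun s _ => ratio_nonneg hk hp01 (h s).1 (hh s))
            fun s _ => hratio2 (h s).1 (h s).2 (hh s)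
      _ = 2 ^ T := by simp
  have hIp := integrable_pulls B π T T 1
  have hIA : Integrable (fun h => runMax (fun _ => 1) 1 (p : ℝ) h T ^ 2) (law B π T) :=
    integrable_of_unitRewards (K := (T : ℝ) ^ 2) ((measurable_runMax _ _ _ T).pow_const 2)
      fun h hh => by
        rw [abs_of_nonneg (sq_nonneg _)]
        have h1 := runMax_le (G := fun _ => 1) (by simp) 1 hp01 hh T
        have h2 := runMax_nonneg (fun _ => 1) 1 (p : ℝ) h T
        gcongr
  -- Reusing the maximal inequality with unit weights costs a factor 4; with the 2k²n term this
  -- makes the 6 of the statement.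
  have hEA : ∫ h, runMax (fun _ => 1) 1 (p : ℝ) h T ^ 2 ∂(law B π T)
      ≤ 4 * ∫ h, (pulls (actions h) T 1 : ℝ) ∂(law B π T) := by
    rw [← hmp]
    exact integral_runMax_sq_le (G := fun _ => 1) (W := fun k => (k : ℝ)) (by simp)
      (fun k => by push_cast; linarith) (by simp) B π T 1
  have hIs : Integrable (fun h => 3 / 4 - k ^ 2 * runMax (fun _ => 1) 1 (p : ℝ) h T ^ 2
      - 2 * k ^ 2 * pulls (actions h) T 1) (law B π T) :=
    ((integrable_const _).sub (hIA.const_mul _)).sub (hIp.const_mul _)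
  rw [h2, estError, hmp]
  change _ ≤ ∫ h, |g (actions h) - p| ∂(law B π T) + _
  rw [← integral_add hI1 hI2]
  calc |(p : ℝ) - q| * (3 / 4 - 6 * k ^ 2 * ∫ h, (pulls (actions h) T 1 : ℝ) ∂(law B π T))
      ≤ |(p : ℝ) - q| * ∫ h, (3 / 4 - k ^ 2 * runMax (fun _ => 1) 1 (p : ℝ) h T ^ 2
          - 2 * k ^ 2 * pulls (actions h) T 1) ∂(law B π T) := by
        refine mul_le_mul_of_nonneg_left ?_ (abs_nonneg _)
        have hc : Integrable (fun h => 3 / 4 - k ^ 2 * runMax (fun _ => 1) 1 (p : ℝ) h T ^ 2)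
          (law B π T) := (integrable_const _).sub (hIA.const_mul _)
        rw [integral_sub hc (hIp.const_mul _), integral_sub (integrable_const _)
          (hIA.const_mul _), integral_const_mul (k ^ 2), integral_const_mul (2 * k ^ 2)]
        simp only [integral_const, probReal_univ, smul_eq_mul, one_mul]
        nlinarith [mul_le_mul_of_nonneg_left hEA (sq_nonneg k)]
    _ = ∫ h, |(p : ℝ) - q| * (3 / 4 - k ^ 2 * runMax (fun _ => 1) 1 (p : ℝ) h T ^ 2
          - 2 * k ^ 2 * pulls (actions h) T 1) ∂(law B π T) := (integral_const_mul _ _).symm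
    _ ≤ ∫ h, (|g (actions h) - p| + (∏ s, ratio k p (h s)) * |g (actions h) - q|)
          ∂(law B π T) := by
        refine integral_mono_ae (hIs.const_mul _) (hI1.add hI2) ?_
        filter_upwards [ae_unitRewards B π T] with h hh
        have hL := le_prod_ratio hk hp01 hh
        have hpos : 0 ≤ ∏ s, ratio k p (h s) :=
          Finset.prod_nonneg fun s _ => ratio_nonneg hk hp01 (h s).1 (hh s)
        set L := ∏ s, ratio k p (h s)
        have hZ : transform (fun _ => 1) 1 (p : ℝ) h T ^ 2
            ≤ runMax (fun _ => 1) 1 (p : ℝ) h T ^ 2 := by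
          rw [← sq_abs (transform _ _ _ _ _)]
          have := abs_transform_le_runMax (fun _ => 1) 1 (p : ℝ) h (le_refl T)
          gcongr
        have hZ' := mul_le_mul_of_nonneg_left hZ (sq_nonneg k)
        have hn : 0 ≤ 2 * k ^ 2 * (pulls (actions h) T 1 : ℝ) := by positivity
        set M := 3 / 4 - k ^ 2 * runMax (fun _ => 1) 1 (p : ℝ) h T ^ 2
          - 2 * k ^ 2 * pulls (actions h) T 1
        have hM1 : M ≤ min 1 L := by
          refine le_min ?_ (by simp only [M]; linarith)
          have := mul_nonneg (sq_nonneg k) (sq_nonneg (runMax (fun _ => 1) 1 (p : ℝ) h T))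
          simp only [M]
          linarith
        have htri : |(p : ℝ) - q| ≤ |g (actions h) - p| + |g (actions h) - q| := by
          rw [abs_sub_comm (g (actions h)) p]
          exact abs_sub_le _ _ _
        have hmin0 : 0 ≤ min 1 L := le_min zero_le_one hpos
        -- Le Cam: whatever the estimate, its distances to p and q add up to at least |p - q|, and
        -- both are weighted by at least min(1, L), with L the likelihood ratio.
        calc |(p : ℝ) - q| * M ≤ |(p : ℝ) - q| * min 1 L := by gcongr
          _ ≤ (|g (actions h) - p| + |g (actions h) - q|) * min 1 L := by gcongr
          _ = |g (actions h) - p| * min 1 L + min 1 L * |g (actions h) - q| := by ring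
          _ ≤ |g (actions h) - p| * 1 + L * |g (actions h) - q| := by
              gcongr
              · exact min_le_left _ _
              · exact min_le_right _ _
          _ = _ := by rw [mul_one]

/-- The mean is lowered by c/32 with c the capped rate, so that c² E n ≤ 1. Then k ≤ c/6, because
p(1 - p) ≥ 3/16, and 6k² E n ≤ 1/4: the two errors add up to at least c/64. -/
lemma exists_hard_instance {B : Bandit} (hBer : B.IsBernoulli) (hB : B.mean 1 < B.mean 0)
    (hmid : ∀ i, |B.mean i - 1 / 2| ≤ 1 / 4) (T : ℕ) (π : Policy) :
    ∃ B' : Bandit, B'.IsBernoulli ∧ B'.mean 1 < B'.mean 0 ∧ B'.bestMean = B.bestMean ∧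
      ∀ est : ℝ → (Fin T → Fin 2) → ℝ,
        1 / 128 * cappedRate (B.gap 1) (regret B π T)
          ≤ max (estError B π T 1 est) (estError B' π T 1 est) := by
  obtain ⟨p, hp⟩ := hBer 1
  obtain ⟨p0, hp0⟩ := hBer 0
  have hΔ := gap_pos hB
  have hmp : B.mean 1 = p := by rw [Bandit.mean, hp, integral_id_bernoulli]
  have hpm := abs_le.mp (hmid 1)
  rw [hmp] at hpm
  set E := ∫ h, (pulls (actions h) T 1 : ℝ) ∂(law B π T) with hE
  have hE0 : 0 ≤ E := integral_nonneg fun h => Nat.cast_nonneg _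
  have hR : regret B π T = B.gap 1 * E := regret_eq hB π T
  set c := cappedRate (B.gap 1) (regret B π T) with hc
  have hc0 : 0 ≤ c := by
    rw [hc, cappedRate]; split_ifs
    · exact zero_le_one
    · positivity
  have hc1 : c ≤ 1 := by
    rw [hc, cappedRate]; split_ifs
    · exact le_rfl
    · exact min_le_right _ _
  -- At zero regret the cap is 1 by convention, but then E = 0 as well.
  have hcE : c ^ 2 * E ≤ 1 := by
    rcases hE0.eq_or_lt with h0 | h0
    · rw [← h0]; norm_num
    · have h1 : c ≤ Real.sqrt (1 / E) := by
        rw [hc, cappedRate, hR, if_neg (by positivity)]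
        refine (min_le_left _ _).trans (le_of_eq ?_)
        congr 1
        field_simp
      have h2 : c ^ 2 ≤ 1 / E := by
        rw [← Real.sq_sqrt (show 0 ≤ 1 / E by positivity)]
        gcongr
      rwa [le_div_iff₀ h0] at h2
  set v : ℝ := p * (1 - p) with hv
  have hv1 : 3 / 16 ≤ v := by
    have : 0 ≤ ((p : ℝ) - 1 / 4) * (3 / 4 - p) := mul_nonneg (by linarith) (by linarith)
    nlinarith
  set k : ℝ := c / 32 / v with hk
  have hk0 : 0 ≤ k := by positivity
  have hkc : k ≤ c / 6 := by
    rw [hk, div_le_iff₀ (by linarith)]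
    nlinarith
  have hkv : k * v = c / 32 := by rw [hk]; field_simp
  have hkabs : |k| ≤ 1 / 6 := by rw [abs_of_nonneg hk0]; linarith
  let q : unitInterval := ⟨p - c / 32, by constructor <;> linarith⟩
  have hq : (q : ℝ) = p - k * (p * (1 - p)) := by
    rw [← hv, hkv]
  have hq' : (q : ℝ) = p - c / 32 := rfl
  have hm0 : (B.withSecond q).mean 0 = B.mean 0 := rfl
  have hm1 : (B.withSecond q).mean 1 = q := by
    have e : (B.withSecond q).reward 1 = bernoulliMeasure (1 : ℝ) 0 q := by
      simp [Bandit.withSecond]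
    rw [Bandit.mean, e, integral_id_bernoulli]
  have hB' : (B.withSecond q).mean 1 < (B.withSecond q).mean 0 := by
    rw [hm0, hm1, hq']
    rw [hmp] at hB
    linarith
  have hbest : (B.withSecond q).bestMean = B.bestMean := by
    rw [Bandit.bestMean, Bandit.bestMean, max_eq_left hB'.le, max_eq_left hB.le, hm0]
  refine ⟨B.withSecond q, fun i => ?_, hB', hbest, fun est => ?_⟩
  · rcases arm_cases i with rfl | rfl
    · exact ⟨p0, by simpa [Bandit.withSecond] using hp0⟩
    · exact ⟨q, by simp [Bandit.withSecond]⟩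
  · have h1 := le_estError_add_estError hp hkabs hq π T hbest est
    rw [← hE, hq', sub_sub_cancel, abs_of_nonneg (by positivity)] at h1
    have h2 : 6 * k ^ 2 * E ≤ 1 / 4 := by
      have : k ^ 2 ≤ (c / 6) ^ 2 := by gcongr
      nlinarith [mul_le_mul_of_nonneg_right this hE0]
    have h3 := le_max_left (estError B π T 1 est) (estError (B.withSecond q) π T 1 est)
    have h4 := le_max_right (estError B π T 1 est) (estError (B.withSecond q) π T 1 est)
    have h5 : c / 32 * (1 / 2) ≤ c / 32 * (3 / 4 - 6 * k ^ 2 * E) := by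
      gcongr; linarith
    linarith

end InverseBandit

/-! ### Assembly of the upper and lower bounds -/

theorem corollary1 :
    (∃ C : ℝ, 0 < C ∧
      ∀ (B : Bandit), B.mean 1 < B.mean 0 →
      ∀ (α : ℝ), 0 ≤ α → α < 1 →
      ∀ (T : ℕ), 2 ≤ T → 64 * (scale α T / B.gap 1 ^ 2) ≤ T →
      ∀ (best : (Fin T → Fin 2) → Fin 2), IsMostPulled best →
      ∀ (π : Policy),
        (IsSAE α T π →
          estError B π T 1 (fun m a => saeEstimate α best m a 1)
            ≤ C * Real.sqrt (B.gap 1 / regret B π T)) ∧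
        (IsUCB α T π →
          estError B π T 1 (fun m a => ucbEstimate α best m a 1)
            ≤ C * Real.sqrt (B.gap 1 / regret B π T)))
    ∧
    (∃ c : ℝ, 0 < c ∧
      ∀ (B : Bandit), B.IsBernoulli → B.mean 1 < B.mean 0 →
      (∀ i, |B.mean i - 1 / 2| ≤ 1 / 4) →
      ∀ (T : ℕ) (π : Policy),
      ∃ B' : Bandit, B'.IsBernoulli ∧ B'.mean 1 < B'.mean 0 ∧ B'.bestMean = B.bestMean ∧
        ∀ est : ℝ → (Fin T → Fin 2) → ℝ,
          c * cappedRate (B.gap 1) (regret B π T)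
            ≤ max (estError B π T 1 est) (estError B' π T 1 est)) := by
  constructor
  -- The UCB constant, coming from K = 4000, also dominates the SAE one, from K = 50.
  · refine ⟨(6 * 4000 + 1) * Real.sqrt (4000 + 8), by positivity,
      fun B hB α hα _ T hT hTL best hbest π => ⟨fun hπ => ?_, fun hπ => ?_⟩⟩
    · refine (sae_estError_le hB hα hT hTL hbest hπ).trans ?_
      gcongr <;> norm_num
    · exact ucb_estError_le hB hα hT hTL hbest hπ
  · exact ⟨1 / 128, by norm_num, fun B hBer hB hmid T π => exists_hard_instance hBer hB hmid T π⟩
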